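/- **Setting.** Let $\mathcal H_{mkt}$ be a complex Hilbert space, $K\ge 2$, $\mathcal K\subset\mathbb R$ bounded and measurable, $\mathcal H_{env}=\mathbb C^K\otimes L^2[\mathcal K]$, and let $e_1,\dots,e_K$ be the standard basis of $\mathbb C^K$. Let $\kappa,\gamma\in\mathbb R$ with $\kappa\gamma\ge 0$, let $A_u,A_d$ be bounded operators on $\mathcal H_{mkt}$, let $H'$ be a bounded self-adjoint operator on $L^2[\mathcal K]$, and let $\rho_B$ be a density operator on $L^2[\mathcal K]$ (the bath state) which is stationary: $[H',\rho_B]=0$. On $\mathcal H_{mkt}\otimes\mathcal H_{env}$ (Hilbert space tensor product) put $$H=H_I+\mathbb I\otimes H_{env},\quad H_I=\sqrt{\kappa\gamma}\sum_{\alpha\in\{u,d\}}A_\alpha\otimes B_\alpha,\quad H_{env}=\gamma\sum_{l=1}^K l\,|e_l\rangle\langle e_l|\otimes H',$$ $$B_u=\sum_{i=1}^{K-1}|e_{i+1}\rangle\langle e_i|\otimes\mathbb I,\qquad B_d=\sum_{i=1}^{K-1}|e_i\rangle\langle e_{i+1}|\otimes\mathbb I .$$ Write $B_\alpha(t)=e^{iH_{env}t}B_\alpha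 e^{-iH_{env}t}$ and $X^I(t)=e^{i(\mathbb I\otimes H_{env})t}Xe^{-i(\mathbb I\otimes H_{env})t}$ for the interaction picture of an operator $X$ on the full space, $H_I(t)$ for the interaction picture of $H_I$, and $\rho^I(t)$ for that of $\rho(t)$. Let $\rho(t)$, $t\ge0$, solve the von Neumann equation $\frac{d}{dt}\rho(t)=-i[H,\rho(t)]$ (derivative in operator norm) with $\rho(0)$ trace class, and let $\rho_{mkt}(t)=\mathrm{Tr}_{env}[\rho(t)]$. Let $r_{lm}(t)\in\mathbb C$ and bounded operators $\rho^{lm}_{mkt}(t)$ on $\mathcal H_{mkt}$ be given for $1\le l,m\le K$, $t\ge 0$, and set $$\rho_{Born}(t)=\sum_{l,m=1}^K\rho^{lm}_{mkt}(t)\otimes r_{lm}(t)|e_l\rangle\langle e_m|\otimes\rho_B .$$ For $\alpha,\beta\in\{u,d\}$ define the correlation functions $$f^{lm}_{\alpha\beta}(t,s)=\kappa\gamma\,\mathrm{Tr}\big[B_\alpha(t)B_\beta(s)\rho^{I,lm}_{env}(s)\big],\qquad g^{lm}_{\alpha\beta}(t,s)=\kappa\gamma\,\mathrm{Tr}\big[B_\alpha(s)B_\beta(t)\rho^{I,lm}_{env}(s)\big],$$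 $$\rho^{I,lm}_{env}(s)=r_{lm}(s)|e_l\rangle\langle e_m|\otimes e^{i\gamma(l-m)sH'}\rho_B ,$$ and $$M(t,s)=\sum_{l,m=1}^K\sum_{\alpha,\beta\in\{u,d\}}\Big\{f^{lm}_{\alpha\beta}(t,s)\big(A_\alpha A_\beta\rho^{lm}_{mkt}(s)-A_\beta\rho^{lm}_{mkt}(s)A_\alpha\big)+g^{lm}_{\alpha\beta}(t,s)\big(\rho^{lm}_{mkt}(s)A_\alpha A_\beta-A_\beta\rho^{lm}_{mkt}(s)A_\alpha\big)\Big\}.$$ **Proposition.** 1. (Born assumption.) If $\rho(t)=\rho_{Born}(t)$ for all $t\ge0$, that is, the bath factor remains equal to the stationary state $\rho_B$, then for every $t\ge 0$ the function $s\mapsto M(t,s)$ is integrable on $[0,t]$ and, in operator norm (one-sided derivative at $t=0$), $$\frac{d\rho_{mkt}(t)}{dt}=-i\,\mathrm{Tr}_{env}[H_I(t),\rho^I(0)]-\int_0^t M(t,s)\,ds .$$ 2. (Without the Born assumption.) If the $\rho^{lm}_{mkt}(s)$ are trace class and all $s\mapsto r_{lm}(s)\rho^{lm}_{mkt}(s)$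 are norm continuous on $[0,\infty)$, then for every $t\ge0$, with all integrands integrable on $[0,t]$, the exact reduced state satisfies $$\frac{d\rho_{mkt}(t)}{dt}=-i\,\mathrm{Tr}_{env}[H_I(t),\rho^I(0)]-\int_0^t M(t,s)\,ds-\int_0^t\mathrm{Tr}_{env}\Big[H_I(t),\big[H_I(s),\rho^I(s)-\rho_{Born}^I(s)\big]\Big]ds ,$$ so the equation of part 1 is what remains when $\rho^I(s)$ is replaced by its Born form in the second-order term. -/

import Mathlib

open MeasureTheory
open scoped TensorProduct InnerProductSpace

noncomputable section

namespace MarketBath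

/-! ### Hilbert tensor products, trace class operators, partial trace -/

section General

variable {E F : Type*} [NormedAddCommGroup E] [InnerProductSpace ℂ E]
  [NormedAddCommGroup F] [InnerProductSpace ℂ F]

/-- The Hilbert space tensor product: the completion of the algebraic tensor product with respect
to the inner product `⟪x ⊗ y, x' ⊗ y'⟫ = ⟪x, x'⟫ ⟪y, y'⟫`. -/
abbrev HTensor (E F : Type*) [NormedAddCommGroup E] [InnerProductSpace ℂ E]
    [NormedAddCommGroup F] [InnerProductSpace ℂ F] : Type _ :=
  UniformSpace.Completion (E ⊗[ℂ] F)

/-- The bounded operator `A ⊗ B` on the Hilbert space tensor product. -/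
def tensorOp (A : E →L[ℂ] E) (B : F →L[ℂ] F) : HTensor E F →L[ℂ] HTensor E F :=
  (TensorProduct.mapL A B).completion

/-- The bounded map `ψ ↦ ψ ⊗ e`. -/
def tensorKet (E : Type*) [NormedAddCommGroup E] [InnerProductSpace ℂ E] (e : F) :
    E →L[ℂ] HTensor E F :=
  (UniformSpace.Completion.toComplL : (E ⊗[ℂ] F) →L[ℂ] HTensor E F) ∘L
    (TensorProduct.mkL ℂ E F).flip e

/-- Trace class operators on a Hilbert space, as the operators with a nuclear representation
`X = ∑ₙ |vₙ⟩⟨uₙ|`, `∑ₙ ‖uₙ‖ ‖vₙ‖ < ∞`. -/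
def IsTraceClass (X : E →L[ℂ] E) : Prop :=
  ∃ u v : ℕ → E, Summable (fun n => ‖u n‖ * ‖v n‖) ∧
    ∀ x, HasSum (fun n => ⟪u n, x⟫_ℂ • v n) (X x)

/-- The index set of a chosen orthonormal (Hilbert) basis. -/
def basisIndex (E : Type*) [NormedAddCommGroup E] [InnerProductSpace ℂ E] [CompleteSpace E] :
    Set E :=
  (exists_hilbertBasis ℂ E).choose

/-- A chosen orthonormal (Hilbert) basis; the traces below do not depend on it for trace class
operators. -/
def basis (E : Type*) [NormedAddCommGroup E] [InnerProductSpace ℂ E] [CompleteSpace E] :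
    HilbertBasis (basisIndex E) ℂ E :=
  (exists_hilbertBasis ℂ E).choose_spec.choose

/-- The trace `Tr X = ∑ᵢ ⟨bᵢ, X bᵢ⟩` of a trace class operator. -/
def trace [CompleteSpace E] (X : E →L[ℂ] E) : ℂ :=
  ∑' i, ⟪basis E i, X (basis E i)⟫_ℂ

/-- The partial trace over the second factor: `⟨φ, (Tr_F X) ψ⟩ = ∑ᵢ ⟨φ ⊗ bᵢ, X (ψ ⊗ bᵢ)⟩`, as a
series of operators on the first factor (absolutely convergent when `X` is trace class). -/
def partialTrace [CompleteSpace E] [CompleteSpace F] (X : HTensor E F →L[ℂ] HTensor E F) :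
    E →L[ℂ] E :=
  ∑' i, (ContinuousLinearMap.adjoint (tensorKet E (basis F i))) ∘L X ∘L tensorKet E (basis F i)

/-- Density operators (quantum states). -/
def IsDensityOperator [CompleteSpace E] (X : E →L[ℂ] E) : Prop :=
  X.IsPositive ∧ IsTraceClass X ∧ trace X = 1

/-- The interaction picture `X^I(t) = e^{i t H₀} X e^{-i t H₀}` with free Hamiltonian `H₀`. -/
def interactionPicture (H₀ : E →L[ℂ] E) (t : ℝ) (X : E →L[ℂ] E) : E →L[ℂ] E :=
  NormedSpace.exp ((Complex.I * (t : ℂ)) • H₀) * X * NormedSpace.exp (-(Complex.I * (t : ℂ)) • H₀)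

end General

/-! ### The environment -/

/-- The two labels `u`, `d` of the interaction operators. -/
inductive Dir
  | u
  | d
  deriving DecidableEq

instance : Fintype Dir where
  elems := {Dir.u, Dir.d}
  complete := by
    intro x
    cases x <;> simp

/-- The Hilbert space `L²[𝒦]`. -/
abbrev L2 (𝒦 : Set ℝ) : Type := Lp ℂ 2 (volume.restrict 𝒦)

/-- The environment Hilbert space `ℂ^K ⊗ L²[𝒦]`. -/
abbrev Env (K : ℕ) (𝒦 : Set ℝ) : Type := HTensor (EuclideanSpace ℂ (Fin K)) (L2 𝒦)

/-- The operator `|e_l⟩⟨e_m|` on `ℂ^K`. -/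
def ketbra {K : ℕ} (l m : Fin K) : EuclideanSpace ℂ (Fin K) →L[ℂ] EuclideanSpace ℂ (Fin K) :=
  InnerProductSpace.rankOne ℂ (EuclideanSpace.single l (1 : ℂ)) (EuclideanSpace.single m (1 : ℂ))

/-- The level number `1, …, K` of a basis vector of `ℂ^K` (indexed from `0` by `Fin K`). -/
def level {K : ℕ} (l : Fin K) : ℝ := (l : ℝ) + 1

/-- `B_u = ∑_{i<K} |e_{i+1}⟩⟨e_i| ⊗ 𝕀` and `B_d = ∑_{i<K} |e_i⟩⟨e_{i+1}| ⊗ 𝕀`. -/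
def opB (K : ℕ) (𝒦 : Set ℝ) : Dir → (Env K 𝒦 →L[ℂ] Env K 𝒦)
  | .u => ∑ i : Fin K, ∑ j : Fin K,
      if (j : ℕ) = (i : ℕ) + 1 then tensorOp (ketbra j i) (1 : L2 𝒦 →L[ℂ] L2 𝒦) else 0
  | .d => ∑ i : Fin K, ∑ j : Fin K,
      if (j : ℕ) = (i : ℕ) + 1 then tensorOp (ketbra i j) (1 : L2 𝒦 →L[ℂ] L2 𝒦) else 0

/-- `H_env = γ ∑_l l |e_l⟩⟨e_l| ⊗ H'`. -/
def hamEnv (K : ℕ) {𝒦 : Set ℝ} (γ : ℝ) (H' : L2 𝒦 →L[ℂ] L2 𝒦) : Env K 𝒦 →L[ℂ] Env K 𝒦 :=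
  (γ : ℂ) • ∑ l : Fin K, (level l : ℂ) • tensorOp (ketbra l l) H'

/-- `B_α(t)`, the interaction picture of `B_α`. -/
def opBI (K : ℕ) {𝒦 : Set ℝ} (γ : ℝ) (H' : L2 𝒦 →L[ℂ] L2 𝒦) (α : Dir) (t : ℝ) :
    Env K 𝒦 →L[ℂ] Env K 𝒦 :=
  interactionPicture (hamEnv K γ H') t (opB K 𝒦 α)

/-- `ρ_env^{I,lm}(s) = r |e_l⟩⟨e_m| ⊗ e^{iγ(l-m)sH'} ρ_B`, with `r = r_{lm}(s)`. -/
def envStateI {K : ℕ} {𝒦 : Set ℝ} (γ : ℝ) (H' ρB : L2 𝒦 →L[ℂ] L2 𝒦) (l m : Fin K) (r : ℂ)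
    (s : ℝ) : Env K 𝒦 →L[ℂ] Env K 𝒦 :=
  tensorOp (r • ketbra l m)
    (NormedSpace.exp ((Complex.I * ((γ * (level l - level m) * s : ℝ) : ℂ)) • H') * ρB)

/-- `f^{lm}_{αβ}(t,s) = κγ Tr[B_α(t) B_β(s) ρ_env^{I,lm}(s)]`. -/
def corrF {K : ℕ} {𝒦 : Set ℝ} (κ γ : ℝ) (H' ρB : L2 𝒦 →L[ℂ] L2 𝒦) (r : Fin K → Fin K → ℝ → ℂ)
    (l m : Fin K) (α β : Dir) (t s : ℝ) : ℂ :=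
  ((κ * γ : ℝ) : ℂ) *
    trace (opBI K γ H' α t * opBI K γ H' β s * envStateI γ H' ρB l m (r l m s) s)

/-- `g^{lm}_{αβ}(t,s) = κγ Tr[B_α(s) B_β(t) ρ_env^{I,lm}(s)]`. -/
def corrG {K : ℕ} {𝒦 : Set ℝ} (κ γ : ℝ) (H' ρB : L2 𝒦 →L[ℂ] L2 𝒦) (r : Fin K → Fin K → ℝ → ℂ)
    (l m : Fin K) (α β : Dir) (t s : ℝ) : ℂ :=
  ((κ * γ : ℝ) : ℂ) *
    trace (opBI K γ H' α s * opBI K γ H' β t * envStateI γ H' ρB l m (r l m s) s)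

/-! ### The full system -/

section System

variable {Hm : Type*} [NormedAddCommGroup Hm] [InnerProductSpace ℂ Hm]

/-- `𝕀 ⊗ H_env` on `H_mkt ⊗ H_env`. -/
def hamFree (Hm : Type*) [NormedAddCommGroup Hm] [InnerProductSpace ℂ Hm] (K : ℕ) {𝒦 : Set ℝ}
    (γ : ℝ) (H' : L2 𝒦 →L[ℂ] L2 𝒦) : HTensor Hm (Env K 𝒦) →L[ℂ] HTensor Hm (Env K 𝒦) :=
  tensorOp (1 : Hm →L[ℂ] Hm) (hamEnv K γ H')

/-- `H_I = √(κγ) ∑_α A_α ⊗ B_α`. -/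
def hamInt (K : ℕ) (𝒦 : Set ℝ) (κ γ : ℝ) (A : Dir → (Hm →L[ℂ] Hm)) :
    HTensor Hm (Env K 𝒦) →L[ℂ] HTensor Hm (Env K 𝒦) :=
  (Real.sqrt (κ * γ) : ℂ) • ∑ α : Dir, tensorOp (A α) (opB K 𝒦 α)

/-- The full Hamiltonian `H = H_I + 𝕀 ⊗ H_env`. -/
def hamFull (K : ℕ) {𝒦 : Set ℝ} (κ γ : ℝ) (A : Dir → (Hm →L[ℂ] Hm)) (H' : L2 𝒦 →L[ℂ] L2 𝒦) :
    HTensor Hm (Env K 𝒦) →L[ℂ] HTensor Hm (Env K 𝒦) :=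
  hamInt K 𝒦 κ γ A + hamFree Hm K γ H'

/-- `H_I(t)`, the interaction picture of `H_I`. -/
def hamIntI (K : ℕ) {𝒦 : Set ℝ} (κ γ : ℝ) (A : Dir → (Hm →L[ℂ] Hm)) (H' : L2 𝒦 →L[ℂ] L2 𝒦)
    (t : ℝ) : HTensor Hm (Env K 𝒦) →L[ℂ] HTensor Hm (Env K 𝒦) :=
  interactionPicture (hamFree Hm K γ H') t (hamInt K 𝒦 κ γ A)

/-- The Born form `∑_{l,m} ρ^{lm}_mkt(t) ⊗ r_{lm}(t) |e_l⟩⟨e_m| ⊗ ρ_B`. -/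
def bornState {K : ℕ} {𝒦 : Set ℝ} (ρB : L2 𝒦 →L[ℂ] L2 𝒦) (r : Fin K → Fin K → ℝ → ℂ)
    (ρlm : Fin K → Fin K → ℝ → (Hm →L[ℂ] Hm)) (t : ℝ) :
    HTensor Hm (Env K 𝒦) →L[ℂ] HTensor Hm (Env K 𝒦) :=
  ∑ l : Fin K, ∑ m : Fin K, tensorOp (ρlm l m t) (tensorOp (r l m t • ketbra l m) ρB)

/-- The Von Neumann equation `dρ/dt = -i [H, ρ]` for `t ≥ 0`. -/
def IsVonNeumannSolution {E : Type*} [NormedAddCommGroup E] [InnerProductSpace ℂ E]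
    (H : E →L[ℂ] E) (ρ : ℝ → (E →L[ℂ] E)) : Prop :=
  ∀ t : ℝ, 0 ≤ t → HasDerivWithinAt ρ (-Complex.I • ⁅H, ρ t⁆) (Set.Ici 0) t

/-- The integrand of the memory term:
`∑_{l,m} ∑_{α,β} f^{lm}_{αβ}(t,s) (A_α A_β ρ^{lm}(s) - A_β ρ^{lm}(s) A_α)
  + g^{lm}_{αβ}(t,s) (ρ^{lm}(s) A_α A_β - A_β ρ^{lm}(s) A_α)`. -/
def memoryKernel {K : ℕ} {𝒦 : Set ℝ} (κ γ : ℝ) (A : Dir → (Hm →L[ℂ] Hm))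
    (H' ρB : L2 𝒦 →L[ℂ] L2 𝒦) (r : Fin K → Fin K → ℝ → ℂ)
    (ρlm : Fin K → Fin K → ℝ → (Hm →L[ℂ] Hm)) (t s : ℝ) : Hm →L[ℂ] Hm :=
  ∑ l : Fin K, ∑ m : Fin K, ∑ α : Dir, ∑ β : Dir,
    (corrF κ γ H' ρB r l m α β t s • (A α * A β * ρlm l m s - A β * ρlm l m s * A α)
      + corrG κ γ H' ρB r l m α β t s • (ρlm l m s * A α * A β - A β * ρlm l m s * A α))

/-- The second-order term produced by the deviation of the exact state from the Born form:
`Tr_env [H_I(t), [H_I(s), (ρ(s) - ρ_Born(s))^I]]`. -/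
def bornRemainder [CompleteSpace Hm] {K : ℕ} {𝒦 : Set ℝ} (κ γ : ℝ) (A : Dir → (Hm →L[ℂ] Hm))
    (H' ρB : L2 𝒦 →L[ℂ] L2 𝒦) (r : Fin K → Fin K → ℝ → ℂ)
    (ρlm : Fin K → Fin K → ℝ → (Hm →L[ℂ] Hm))
    (ρ : ℝ → (HTensor Hm (Env K 𝒦) →L[ℂ] HTensor Hm (Env K 𝒦))) (t s : ℝ) : Hm →L[ℂ] Hm :=
  partialTrace ⁅hamIntI K κ γ A H' t, ⁅hamIntI K κ γ A H' s,
    interactionPicture (hamFree Hm K γ H') s (ρ s - bornState ρB r ρlm s)⁆⁆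

end System

end MarketBath

end

/-!
The state solves a linear equation with bounded generator, so `ρ(t) = e^{-iHt} ρ(0) e^{iHt}`
(`eq_evolution_of_hasDerivWithinAt`), and everything about its reduction follows from one object:
for a fixed trace class `X`, the map `(L, R) ↦ Tr_F [L X R]` is a bounded bilinear map on pairs of
bounded operators (`IsTraceClass.partialTraceL`). Convergence of the series for the partial trace
comes from Bessel's inequality for the slices of a nuclear representation of `X`, and the bound
comes from the identity `⟨φ, (Tr_F X) ψ⟩ = Tr [⟨φ| X |ψ⟩]` together with the basis independent
formula `Tr X = ∑ₙ ⟨uₙ, vₙ⟩`. The same identity shows that the partial trace is cyclic for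
operators that act on the traced factor only (`IsTraceClass.partialTrace_mul_comm`), so that the
free evolution `𝕀 ⊗ H_env` is invisible in the reduced state.

With such a bilinear map the second-order equation is calculus in a Banach algebra
(`hasDerivAt_reduced`): the derivative of the reduced state at time `t` is `-i Tr_env [H_I(t),
ρ^I(t)]`, and the fundamental theorem of calculus for `s ↦ Tr_env [H_I(t), ρ^I(s)]` on `[0, t]`
turns it into the initial term minus `∫ Tr_env [H_I(t), [H_I(s), ρ^I(s)]] ds`, exactly.

It remains to evaluate the integrand on a state in Born form. The matrix units `|e_l⟩⟨e_m|`
intertwine `H_env` with multiples of `H'`, and `ρ_B` commutes with `H'`, so the environment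
factors in the interaction picture are the operators `ρ_env^{I,lm}(s)` (`rotate_hamEnv_tensorOp`).
The partial trace of `A ⊗ η` is `Tr(η) A`, even when `A` is merely bounded, and cyclicity of the
trace brings the four orderings of the double commutator to the correlation functions `f` and `g`
(`hasPartialTrace_memoryKernel`). Under the Born assumption the integrand therefore is the memory
kernel; without it, the difference is the partial trace for `ρ - ρ_Born`, by linearity. The exact
integrand is continuous in `s`, which gives the integrability of the memory kernel under the Born
assumption; without it, the kernel is integrable because it depends continuously on the products
`r_{lm} ρ^{lm}` (`continuousOn_memoryKernel`).
-/

noncomputable section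

namespace MarketBath

/-! ### One-parameter groups in a Banach algebra -/

section Evolution

variable {𝔸 𝔹 : Type*} [NormedRing 𝔸] [NormedAlgebra ℂ 𝔸] [NormedRing 𝔹] [NormedAlgebra ℂ 𝔹]

/-- The one-parameter group `e^{i t a}` generated by `a`. -/
def evolution (a : 𝔸) (t : ℝ) : 𝔸 := NormedSpace.exp ((Complex.I * (t : ℂ)) • a)

@[simp] theorem evolution_zero (a : 𝔸) : evolution a 0 = 1 := by
  simp [evolution]

variable [CompleteSpace 𝔸]

theorem map_exp_of_continuous (f : 𝔸 →ₐ[ℂ] 𝔹) (hf : Continuous f) (a : 𝔸) :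
    f (NormedSpace.exp a) = NormedSpace.exp (f a) :=
  letI := NormedAlgebra.restrictScalars ℚ ℂ 𝔸
  letI := NormedAlgebra.restrictScalars ℚ ℂ 𝔹
  NormedSpace.map_exp f hf a

theorem map_evolution (f : 𝔸 →ₐ[ℂ] 𝔹) (hf : Continuous f) (a : 𝔸) (t : ℝ) :
    f (evolution a t) = evolution (f a) t := by
  rw [evolution, map_exp_of_continuous f hf, map_smul, evolution]

theorem semiconjBy_evolution {x a b : 𝔸} (h : SemiconjBy x a b) (t : ℝ) :
    SemiconjBy x (evolution a t) (evolution b t) :=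
  letI := NormedAlgebra.restrictScalars ℚ ℂ 𝔸
  (h.smul_right _).exp_right

theorem evolution_add (a : 𝔸) (s t : ℝ) :
    evolution a (s + t) = evolution a s * evolution a t := by
  let := NormedAlgebra.restrictScalars ℚ ℂ 𝔸
  rw [evolution, evolution, evolution, Complex.ofReal_add, mul_add, add_smul,
    NormedSpace.exp_add_of_commute]
  exact ((Commute.refl a).smul_left _).smul_right _

@[simp] theorem evolution_neg_mul (a : 𝔸) (t : ℝ) : evolution a (-t) * evolution a t = 1 := by
  rw [← evolution_add, neg_add_cancel, evolution_zero]

@[simp] theorem evolution_neg_mul_cancel (a b : 𝔸) (t : ℝ) :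
    evolution a (-t) * (evolution a t * b) = b := by
  rw [← mul_assoc, evolution_neg_mul, one_mul]

theorem commute_evolution (a : 𝔸) (t : ℝ) : Commute a (evolution a t) :=
  semiconjBy_evolution (Commute.refl a) t

theorem hasDerivAt_evolution (a : 𝔸) (t : ℝ) :
    HasDerivAt (evolution a) (Complex.I • (evolution a t * a)) t := by
  have h : ∀ s : ℝ, evolution a s = NormedSpace.exp (s • (Complex.I • a)) := fun s => by
    rw [evolution, mul_comm, mul_smul, Complex.coe_smul]
  have := hasDerivAt_exp_smul_const (𝕂 := ℝ) (Complex.I • a) t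
  rw [← h, mul_smul_comm] at this
  exact this.congr_of_eventuallyEq (Filter.Eventually.of_forall h)

theorem hasDerivAt_evolution_neg (a : 𝔸) (t : ℝ) :
    HasDerivAt (fun s => evolution a (-s)) (-Complex.I • (a * evolution a (-t))) t := by
  have := (hasDerivAt_evolution a (-t)).scomp t (hasDerivAt_neg t)
  rw [(commute_evolution a (-t)).eq, neg_smul]
  refine (this.congr_deriv ?_ : HasDerivAt (fun s => evolution a (-s)) _ t)
  rw [neg_one_smul]

@[fun_prop] theorem continuous_evolution (a : 𝔸) : Continuous (evolution a) :=
  continuous_iff_continuousAt.2 fun t => (hasDerivAt_evolution a t).continuousAt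

/-- The von Neumann equation is solved by conjugation with the evolution only. -/
theorem eq_evolution_of_hasDerivWithinAt {H : 𝔸} {ρ : ℝ → 𝔸}
    (h : ∀ t : ℝ, 0 ≤ t → HasDerivWithinAt ρ (-Complex.I • ⁅H, ρ t⁆) (Set.Ici 0) t)
    {t : ℝ} (ht : 0 ≤ t) : ρ t = evolution H (-t) * ρ 0 * evolution H t := by
  -- In the rotating frame the solution is constant.
  have hd : ∀ s : ℝ, 0 ≤ s →
      HasDerivWithinAt (fun s => evolution H s * ρ s * evolution H (-s)) 0 (Set.Ici 0) s := by
    intro s hs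
    have := (((hasDerivAt_evolution H s).hasDerivWithinAt (s := Set.Ici 0)).mul (h s hs)).mul
      ((hasDerivAt_evolution_neg H s).hasDerivWithinAt (s := Set.Ici 0))
    refine this.congr_deriv ?_
    simp only [Pi.mul_apply]
    simp only [Ring.lie_def, smul_mul_assoc, mul_smul_comm, mul_neg, neg_mul, mul_sub,
      sub_mul, smul_sub, add_mul, neg_smul, mul_assoc]
    abel
  have hc := constant_of_has_deriv_right_zero (a := 0) (b := t)
    (f := fun s => evolution H s * ρ s * evolution H (-s))
    (fun s hs => (hd s hs.1).continuousWithinAt.mono Set.Icc_subset_Ici_self)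
    (fun s hs => (hd s hs.1).mono (Set.Ici_subset_Ici.2 hs.1)) t (Set.right_mem_Icc.2 ht)
  simp only [evolution_zero, neg_zero, one_mul, mul_one] at hc
  rw [← hc]
  simp [mul_assoc]

end Evolution

/-! ### Operators on the Hilbert space tensor product -/

section Tensor

variable {E F : Type*} [NormedAddCommGroup E] [InnerProductSpace ℂ E]
  [NormedAddCommGroup F] [InnerProductSpace ℂ F]

/-- The elementary tensor `x ⊗ y` in the Hilbert space tensor product. -/
def tmul (x : E) (y : F) : HTensor E F := ((x ⊗ₜ[ℂ] y : E ⊗[ℂ] F) : HTensor E F)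

@[simp] theorem tensorKet_apply (x : E) (y : F) : tensorKet E y x = tmul x y := by
  simp [tensorKet, tmul, TensorProduct.mkL_apply_apply]

@[simp] theorem tensorOp_tmul (A : E →L[ℂ] E) (B : F →L[ℂ] F) (x : E) (y : F) :
    tensorOp A B (tmul x y) = tmul (A x) (B y) := by
  simp [tensorOp, tmul]

theorem inner_tmul (x x' : E) (y y' : F) :
    ⟪tmul x y, tmul x' y'⟫_ℂ = ⟪x, x'⟫_ℂ * ⟪y, y'⟫_ℂ := by
  simp [tmul]

theorem norm_tmul (x : E) (y : F) : ‖tmul x y‖ = ‖x‖ * ‖y‖ := by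
  simp [tmul]

/-- The bounded map `y ↦ x ⊗ y`. -/
def tensorKetLeft (F : Type*) [NormedAddCommGroup F] [InnerProductSpace ℂ F] (x : E) :
    F →L[ℂ] HTensor E F :=
  (UniformSpace.Completion.toComplL : (E ⊗[ℂ] F) →L[ℂ] HTensor E F) ∘L TensorProduct.mkL ℂ E F x

@[simp] theorem tensorKetLeft_apply (x : E) (y : F) : tensorKetLeft F x y = tmul x y := by
  simp [tensorKetLeft, tmul]

theorem tmul_smul_right (c : ℂ) (x : E) (y : F) : tmul x (c • y) = c • tmul x y := by
  rw [← tensorKetLeft_apply, map_smul, tensorKetLeft_apply]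

theorem tmul_smul_left (c : ℂ) (x : E) (y : F) : tmul (c • x) y = c • tmul x y := by
  rw [← tensorKet_apply, map_smul, tensorKet_apply]

theorem norm_tensorKetLeft_le (x : E) : ‖tensorKetLeft F x‖ ≤ ‖x‖ :=
  ContinuousLinearMap.opNorm_le_bound _ (norm_nonneg _) fun y => by simp [norm_tmul]

/-- Bounded operators out of a Hilbert space tensor product agree when they agree on elementary
tensors. -/
theorem ext_tmul {G : Type*} [NormedAddCommGroup G] [NormedSpace ℂ G]
    {S T : HTensor E F →L[ℂ] G} (h : ∀ x y, S (tmul x y) = T (tmul x y)) : S = T := by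
  ext z
  induction z using UniformSpace.Completion.induction_on with
  | hp => exact isClosed_eq S.continuous T.continuous
  | ih z =>
    induction z using TensorProduct.induction_on with
    | zero => rw [UniformSpace.Completion.coe_zero, map_zero, map_zero]
    | tmul x y => exact h x y
    | add a b ha hb => rw [UniformSpace.Completion.coe_add, map_add, map_add, ha, hb]

/-- Vectors of a Hilbert space tensor product agree when they have the same inner products with
elementary tensors. -/
theorem ext_inner_tmul {z w : HTensor E F} (h : ∀ x y, ⟪z, tmul x y⟫_ℂ = ⟪w, tmul x y⟫_ℂ) :
    z = w :=
  innerSL_inj.1 (ext_tmul (S := innerSL ℂ z) (T := innerSL ℂ w) h)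

theorem tensorOp_mul (A A' : E →L[ℂ] E) (B B' : F →L[ℂ] F) :
    tensorOp A B * tensorOp A' B' = tensorOp (A * A') (B * B') :=
  ext_tmul fun x y => by simp

@[simp] theorem tensorOp_one : tensorOp (1 : E →L[ℂ] E) (1 : F →L[ℂ] F) = 1 :=
  ext_tmul fun x y => by simp

theorem tensorOp_smul_right (c : ℂ) (A : E →L[ℂ] E) (B : F →L[ℂ] F) :
    tensorOp A (c • B) = c • tensorOp A B :=
  ext_tmul fun x y => by simp [tmul_smul_right]

theorem tensorOp_smul_left (c : ℂ) (A : E →L[ℂ] E) (B : F →L[ℂ] F) :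
    tensorOp (c • A) B = c • tensorOp A B :=
  ext_tmul fun x y => by simp [tmul_smul_left]

theorem tensorOp_add_right (A : E →L[ℂ] E) (B B' : F →L[ℂ] F) :
    tensorOp A (B + B') = tensorOp A B + tensorOp A B' := by
  refine ext_tmul fun x y => ?_
  simp only [add_apply, tensorOp_tmul]
  rw [← tensorKetLeft_apply, map_add, tensorKetLeft_apply, tensorKetLeft_apply]

theorem norm_tensorOp_le (A : E →L[ℂ] E) (B : F →L[ℂ] F) : ‖tensorOp A B‖ ≤ ‖A‖ * ‖B‖ := by
  refine ContinuousLinearMap.opNorm_le_bound _ (by positivity) fun z => ?_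
  induction z using UniformSpace.Completion.induction_on with
  | hp => exact isClosed_le (by fun_prop) (by fun_prop)
  | ih z =>
    rw [tensorOp, ContinuousLinearMap.completion_apply_coe, UniformSpace.Completion.norm_coe,
      UniformSpace.Completion.norm_coe]
    exact ((TensorProduct.mapL A B).le_opNorm z).trans
      (mul_le_mul_of_nonneg_right (TensorProduct.norm_mapL_le A B) (norm_nonneg z))

/-- `B ↦ A ⊗ B` as a linear map. -/
def tensorOpRight (F : Type*) [NormedAddCommGroup F] [InnerProductSpace ℂ F] (A : E →L[ℂ] E) :
    (F →L[ℂ] F) →ₗ[ℂ] (HTensor E F →L[ℂ] HTensor E F) where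
  toFun B := tensorOp A B
  map_add' := tensorOp_add_right A
  map_smul' c B := tensorOp_smul_right c A B

/-- `B ↦ 𝕀 ⊗ B` as a unital algebra homomorphism. -/
def oneTensorHom (E F : Type*) [NormedAddCommGroup E] [InnerProductSpace ℂ E]
    [NormedAddCommGroup F] [InnerProductSpace ℂ F] :
    (F →L[ℂ] F) →ₐ[ℂ] (HTensor E F →L[ℂ] HTensor E F) :=
  AlgHom.ofLinearMap (tensorOpRight F 1) tensorOp_one fun B B' => by
    simp [tensorOpRight, tensorOp_mul]

theorem continuous_oneTensorHom : Continuous (oneTensorHom E F) :=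
  AddMonoidHomClass.continuous_of_bound (oneTensorHom E F) ‖(1 : E →L[ℂ] E)‖
    fun B => norm_tensorOp_le 1 B

theorem tensorOp_one_evolution [CompleteSpace F] (B : F →L[ℂ] F) (t : ℝ) :
    tensorOp (1 : E →L[ℂ] E) (evolution B t) = evolution (tensorOp 1 B) t :=
  map_evolution (𝔹 := HTensor E F →L[ℂ] HTensor E F) (oneTensorHom E F)
    continuous_oneTensorHom B t

theorem tensorOp_comp_tensorKetLeft (B : F →L[ℂ] F) (x : E) :
    tensorOp 1 B ∘L tensorKetLeft F x = tensorKetLeft F x ∘L B := by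
  ext y; simp

variable [CompleteSpace E]

theorem adjoint_tensorKet_tmul (x : E) (y y' : F) :
    ContinuousLinearMap.adjoint (tensorKet E y) (tmul x y') = ⟪y, y'⟫_ℂ • x := by
  refine ext_inner_right ℂ fun x' => ?_
  rw [ContinuousLinearMap.adjoint_inner_left, tensorKet_apply, inner_tmul, inner_smul_left,
    inner_conj_symm, mul_comm]

variable [CompleteSpace F]

theorem adjoint_tensorOp (A : E →L[ℂ] E) (B : F →L[ℂ] F) :
    ContinuousLinearMap.adjoint (tensorOp A B) =
      tensorOp (ContinuousLinearMap.adjoint A) (ContinuousLinearMap.adjoint B) := by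
  refine ext_tmul fun x y => ext_inner_tmul fun x' y' => ?_
  rw [ContinuousLinearMap.adjoint_inner_left, tensorOp_tmul, tensorOp_tmul, inner_tmul, inner_tmul,
    ContinuousLinearMap.adjoint_inner_left, ContinuousLinearMap.adjoint_inner_left]

theorem adjoint_tensorKetLeft_comp_tensorOp (B : F →L[ℂ] F) (x : E) :
    ContinuousLinearMap.adjoint (tensorKetLeft F x) ∘L tensorOp 1 B =
      B ∘L ContinuousLinearMap.adjoint (tensorKetLeft F x) := by
  have := congrArg ContinuousLinearMap.adjoint
    (tensorOp_comp_tensorKetLeft (ContinuousLinearMap.adjoint B) x)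
  rw [ContinuousLinearMap.adjoint_comp, ContinuousLinearMap.adjoint_comp, adjoint_tensorOp,
    ContinuousLinearMap.adjoint_adjoint] at this
  rwa [← ContinuousLinearMap.star_eq_adjoint (1 : E →L[ℂ] E), star_one] at this

end Tensor

/-! ### The trace of a trace class operator -/

/-- A double series of products is summable as soon as both factors satisfy a Bessel inequality in
the first index and the Bessel bounds have a summable product. -/
theorem summable_mul_of_bessel {ι : Type*} {a b : ι → ℕ → ℝ} {A B : ℕ → ℝ}
    (ha : ∀ i n, 0 ≤ a i n) (hb : ∀ i n, 0 ≤ b i n) (hA : ∀ n, 0 ≤ A n) (hB : ∀ n, 0 ≤ B n)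
    (haA : ∀ n (S : Finset ι), ∑ i ∈ S, a i n ^ 2 ≤ A n ^ 2)
    (hbB : ∀ n (S : Finset ι), ∑ i ∈ S, b i n ^ 2 ≤ B n ^ 2)
    (h : Summable fun n => A n * B n) :
    Summable fun p : ι × ℕ => a p.1 p.2 * b p.1 p.2 := by
  classical
  refine summable_of_sum_le (c := ∑' n, A n * B n)
    (fun p => mul_nonneg (ha _ _) (hb _ _)) fun T => ?_
  calc ∑ p ∈ T, a p.1 p.2 * b p.1 p.2
      ≤ ∑ p ∈ T.image Prod.fst ×ˢ T.image Prod.snd, a p.1 p.2 * b p.1 p.2 :=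
        Finset.sum_le_sum_of_subset_of_nonneg Finset.subset_product
          fun p _ _ => mul_nonneg (ha _ _) (hb _ _)
    _ = ∑ n ∈ T.image Prod.snd, ∑ i ∈ T.image Prod.fst, a i n * b i n :=
        Finset.sum_product_right _ _ _
    _ ≤ ∑ n ∈ T.image Prod.snd, A n * B n := by
        refine Finset.sum_le_sum fun n _ => (Real.sum_mul_le_sqrt_mul_sqrt _ _ _).trans ?_
        exact mul_le_mul (Real.sqrt_le_iff.2 ⟨hA n, haA n _⟩) (Real.sqrt_le_iff.2 ⟨hB n, hbB n _⟩)
          (Real.sqrt_nonneg _) (hA n)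
    _ ≤ ∑' n, A n * B n := h.sum_le_tsum _ fun n _ => mul_nonneg (hA n) (hB n)

section Trace

variable {E F : Type*} [NormedAddCommGroup E] [InnerProductSpace ℂ E]
  [NormedAddCommGroup F] [InnerProductSpace ℂ F]

/-- A nuclear representation `X = ∑ₙ |vₙ⟩⟨uₙ|` with `∑ₙ ‖uₙ‖ ‖vₙ‖ < ∞`. -/
structure IsNuclearRep (X : E →L[ℂ] E) (u v : ℕ → E) : Prop where
  summable : Summable fun n => ‖u n‖ * ‖v n‖
  hasSum : ∀ x, HasSum (fun n => ⟪u n, x⟫_ℂ • v n) (X x)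

theorem IsTraceClass.exists_rep {X : E →L[ℂ] E} (h : IsTraceClass X) :
    ∃ u v, IsNuclearRep X u v :=
  let ⟨u, v, hs, hX⟩ := h
  ⟨u, v, hs, hX⟩

theorem IsNuclearRep.isTraceClass {X : E →L[ℂ] E} {u v : ℕ → E} (h : IsNuclearRep X u v) :
    IsTraceClass X :=
  ⟨u, v, h.summable, h.hasSum⟩

variable {X : E →L[ℂ] E} {u v : ℕ → E}

/-- In any Hilbert basis, the diagonal of a trace class operator sums to `∑ₙ ⟨uₙ, vₙ⟩`. -/
theorem IsNuclearRep.hasSum_inner {ι : Type*} (h : IsNuclearRep X u v) (b : HilbertBasis ι ℂ E) :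
    HasSum (fun i => ⟪b i, X (b i)⟫_ℂ) (∑' n, ⟪u n, v n⟫_ℂ) := by
  have hsum : Summable fun p : ι × ℕ => ⟪u p.2, b p.1⟫_ℂ * ⟪b p.1, v p.2⟫_ℂ := by
    refine Summable.of_norm ?_
    simp only [norm_mul]
    refine summable_mul_of_bessel (a := fun i n => ‖⟪u n, b i⟫_ℂ‖)
      (b := fun i n => ‖⟪b i, v n⟫_ℂ‖) (A := fun n => ‖u n‖) (B := fun n => ‖v n‖)
      (fun _ _ => norm_nonneg _) (fun _ _ => norm_nonneg _) (fun _ => norm_nonneg _)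
      (fun _ => norm_nonneg _) (fun n S => ?_) (fun n S => ?_) h.summable
    · simp only [norm_inner_symm (u n)]
      exact b.orthonormal.sum_inner_products_le _
    · exact b.orthonormal.sum_inner_products_le _
  -- The double series is summed first over `n` and then over the basis, and conversely.
  have h1 : HasSum (fun i => ⟪b i, X (b i)⟫_ℂ)
      (∑' p : ι × ℕ, ⟪u p.2, b p.1⟫_ℂ * ⟪b p.1, v p.2⟫_ℂ) := by
    refine hsum.hasSum.prod_fiberwise fun i => ?_
    simpa [Function.comp_def, inner_smul_right] using
      (innerSL ℂ (b i)).hasSum (h.hasSum (b i))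
  have h2 : HasSum (fun n => ⟪u n, v n⟫_ℂ)
      (∑' p : ι × ℕ, ⟪u p.2, b p.1⟫_ℂ * ⟪b p.1, v p.2⟫_ℂ) := by
    have := (Equiv.prodComm ℕ ι).hasSum_iff.2 hsum.hasSum
    exact this.prod_fiberwise fun n => b.hasSum_inner_mul_inner (u n) (v n)
  rwa [h2.tsum_eq]

variable [CompleteSpace E] [CompleteSpace F]

/-- Bounded operators between different spaces carry a nuclear representation along. -/
theorem IsNuclearRep.comp (h : IsNuclearRep X u v) (Y : E →L[ℂ] F) (Z : F →L[ℂ] E) :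
    IsNuclearRep (Y ∘L X ∘L Z) (fun n => ContinuousLinearMap.adjoint Z (u n))
      (fun n => Y (v n)) where
  summable := by
    refine Summable.of_nonneg_of_le (fun n => by positivity) (fun n => ?_)
      (h.summable.mul_left (‖Z‖ * ‖Y‖))
    have h1 : ‖ContinuousLinearMap.adjoint Z (u n)‖ ≤ ‖Z‖ * ‖u n‖ := by
      simpa using (ContinuousLinearMap.adjoint Z).le_opNorm (u n)
    calc _ ≤ (‖Z‖ * ‖u n‖) * (‖Y‖ * ‖v n‖) :=
          mul_le_mul h1 (Y.le_opNorm _) (norm_nonneg _) (by positivity)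
      _ = _ := by ring
  hasSum x := by
    have := Y.hasSum (h.hasSum (Z x))
    simpa [Function.comp_def, ContinuousLinearMap.adjoint_inner_left] using this

theorem IsTraceClass.comp (h : IsTraceClass X) (Y : E →L[ℂ] F) (Z : F →L[ℂ] E) :
    IsTraceClass (Y ∘L X ∘L Z) :=
  let ⟨_, _, hr⟩ := h.exists_rep
  (hr.comp Y Z).isTraceClass

theorem IsTraceClass.mul_left (h : IsTraceClass X) (Y : E →L[ℂ] E) : IsTraceClass (Y * X) := by
  simpa [ContinuousLinearMap.mul_def, ContinuousLinearMap.one_def] using h.comp Y 1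

theorem IsTraceClass.mul_right (h : IsTraceClass X) (Z : E →L[ℂ] E) : IsTraceClass (X * Z) := by
  simpa [ContinuousLinearMap.mul_def, ContinuousLinearMap.one_def] using h.comp 1 Z

theorem IsNuclearRep.trace_eq (h : IsNuclearRep X u v) : trace X = ∑' n, ⟪u n, v n⟫_ℂ :=
  (h.hasSum_inner (basis E)).tsum_eq

theorem IsTraceClass.hasSum_trace (h : IsTraceClass X) :
    HasSum (fun i => ⟪basis E i, X (basis E i)⟫_ℂ) (trace X) := by
  obtain ⟨u, v, hr⟩ := h.exists_rep
  rw [hr.trace_eq]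
  exact hr.hasSum_inner _

theorem IsTraceClass.trace_mul_comm (h : IsTraceClass X) (C : E →L[ℂ] E) :
    trace (X * C) = trace (C * X) := by
  obtain ⟨u, v, hr⟩ := h.exists_rep
  have h1 := (hr.comp 1 C).trace_eq
  have h2 := (hr.comp C 1).trace_eq
  simp only [ContinuousLinearMap.adjoint_inner_left, ContinuousLinearMap.one_def,
    ContinuousLinearMap.comp_id, ContinuousLinearMap.id_comp, ContinuousLinearMap.id_apply]
    at h1 h2
  exact h1.trans h2.symm

theorem IsNuclearRep.norm_trace_comp_le (h : IsNuclearRep X u v) (Y : E →L[ℂ] F)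
    (Z : F →L[ℂ] E) :
    ‖trace (Y ∘L X ∘L Z)‖ ≤ (∑' n, ‖u n‖ * ‖v n‖) * ‖Y‖ * ‖Z‖ := by
  rw [(h.comp Y Z).trace_eq, mul_assoc, ← tsum_mul_right]
  refine tsum_of_norm_bounded (h.summable.mul_right _).hasSum fun n => ?_
  rw [ContinuousLinearMap.adjoint_inner_left]
  calc ‖⟪u n, Z (Y (v n))⟫_ℂ‖ ≤ ‖u n‖ * ‖Z (Y (v n))‖ := norm_inner_le_norm _ _
    _ ≤ ‖u n‖ * (‖Z‖ * (‖Y‖ * ‖v n‖)) := by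
        gcongr
        exact (Z.le_opNorm _).trans (by gcongr; exact Y.le_opNorm _)
    _ = _ := by ring

theorem IsTraceClass.trace_add {X' : E →L[ℂ] E} (h : IsTraceClass X) (h' : IsTraceClass X') :
    trace (X + X') = trace X + trace X' := by
  refine HasSum.tsum_eq ?_
  simpa [inner_add_right] using h.hasSum_trace.add h'.hasSum_trace

theorem trace_smul (c : ℂ) (X : E →L[ℂ] E) : trace (c • X) = c * trace X := by
  simp [trace, tsum_mul_left]

/-- Multiplying a trace class operator by a norm continuous family gives a continuous trace. -/
theorem IsTraceClass.continuous_trace_mul {α : Type*} [TopologicalSpace α] (h : IsTraceClass X)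
    {Y : α → (E →L[ℂ] E)} (hY : Continuous Y) : Continuous fun a => trace (Y a * X) := by
  obtain ⟨u, v, hr⟩ := h.exists_rep
  let L : (E →L[ℂ] E) →L[ℂ] ℂ := LinearMap.mkContinuous
    { toFun := fun Y => trace (Y * X)
      map_add' := fun Y Y' => by rw [add_mul, (h.mul_left Y).trace_add (h.mul_left Y')]
      map_smul' := fun c Y => by rw [smul_mul_assoc, trace_smul]; rfl }
    ((∑' n, ‖u n‖ * ‖v n‖) * ‖(1 : E →L[ℂ] E)‖) fun Y => by
      have := hr.norm_trace_comp_le Y 1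
      rw [mul_right_comm] at this
      exact this
  exact L.continuous.comp hY

end Trace

/-! ### The partial trace -/

section PartialTrace

variable {E F : Type*} [NormedAddCommGroup E] [InnerProductSpace ℂ E] [CompleteSpace E]
  [NormedAddCommGroup F] [InnerProductSpace ℂ F]

/-- Bessel's inequality for the slices `⟨bᵢ|z` of a vector along an orthonormal family. -/
theorem sum_norm_adjoint_tensorKet_sq_le {ι : Type*} {b : ι → F} (hb : Orthonormal ℂ b)
    (z : HTensor E F) (S : Finset ι) :
    ∑ i ∈ S, ‖ContinuousLinearMap.adjoint (tensorKet E (b i)) z‖ ^ 2 ≤ ‖z‖ ^ 2 := by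
  classical
  set y : ι → E := fun i => ContinuousLinearMap.adjoint (tensorKet E (b i)) z with hy
  set w : HTensor E F := ∑ i ∈ S, tmul (y i) (b i) with hw
  -- `w` is the projection of `z` on the span of the slices.
  have hwz : ⟪w, z⟫_ℂ = ((∑ i ∈ S, ‖y i‖ ^ 2 : ℝ) : ℂ) := by
    rw [hw, sum_inner, Complex.ofReal_sum]
    refine Finset.sum_congr rfl fun i _ => ?_
    rw [← tensorKet_apply, ← ContinuousLinearMap.adjoint_inner_right, inner_self_eq_norm_sq_to_K]
    norm_cast
  have hww : ⟪w, w⟫_ℂ = ((∑ i ∈ S, ‖y i‖ ^ 2 : ℝ) : ℂ) := by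
    rw [hw, sum_inner, Complex.ofReal_sum]
    refine Finset.sum_congr rfl fun i hi => ?_
    rw [inner_sum, Finset.sum_eq_single i]
    · rw [inner_tmul, inner_self_eq_norm_sq_to_K, inner_self_eq_norm_sq_to_K, hb.1 i]
      norm_num
    · intro j _ hj
      rw [inner_tmul, hb.2 hj.symm, mul_zero]
    · exact fun h => absurd hi h
  have hn : ∑ i ∈ S, ‖y i‖ ^ 2 = ‖w‖ ^ 2 := by
    have := inner_self_eq_norm_sq_to_K (𝕜 := ℂ) w
    rw [hww] at this
    exact Complex.ofReal_injective (by rw [this]; simp)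
  have hle : ‖w‖ ^ 2 ≤ ‖w‖ * ‖z‖ := by
    have := norm_inner_le_norm (𝕜 := ℂ) w z
    rw [hwz, hn, Complex.norm_real, Real.norm_of_nonneg (by positivity)] at this
    exact this
  rw [hn]
  have : ‖w‖ ≤ ‖z‖ := by
    by_contra! hlt
    nlinarith [norm_nonneg z]
  gcongr

variable [CompleteSpace F] {X Y : HTensor E F →L[ℂ] HTensor E F}

/-- The series defining the partial trace of `X` converges in norm to `T`. -/
def HasPartialTrace (X : HTensor E F →L[ℂ] HTensor E F) (T : E →L[ℂ] E) : Prop :=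
  HasSum (fun i => ContinuousLinearMap.adjoint (tensorKet E (basis F i)) ∘L X ∘L
    tensorKet E (basis F i)) T

theorem HasPartialTrace.eq {T : E →L[ℂ] E} (h : HasPartialTrace X T) : partialTrace X = T :=
  HasSum.tsum_eq h

theorem HasPartialTrace.add {S T : E →L[ℂ] E} (h : HasPartialTrace X S)
    (h' : HasPartialTrace Y T) : HasPartialTrace (X + Y) (S + T) := by
  simpa [HasPartialTrace] using HasSum.add h h'

theorem HasPartialTrace.sub {S T : E →L[ℂ] E} (h : HasPartialTrace X S)
    (h' : HasPartialTrace Y T) : HasPartialTrace (X - Y) (S - T) := by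
  simpa [HasPartialTrace] using HasSum.sub h h'

theorem HasPartialTrace.smul {T : E →L[ℂ] E} (c : ℂ) (h : HasPartialTrace X T) :
    HasPartialTrace (c • X) (c • T) := by
  simpa [HasPartialTrace] using HasSum.const_smul c h

theorem HasPartialTrace.sum {ι : Type*} {s : Finset ι}
    {X : ι → (HTensor E F →L[ℂ] HTensor E F)} {T : ι → (E →L[ℂ] E)}
    (h : ∀ i ∈ s, HasPartialTrace (X i) (T i)) :
    HasPartialTrace (∑ i ∈ s, X i) (∑ i ∈ s, T i) := by
  simpa [HasPartialTrace, ContinuousLinearMap.comp_finsetSum, ContinuousLinearMap.finsetSum_comp]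
    using hasSum_sum h

/-- The partial trace of a trace class operator converges in norm. -/
theorem IsTraceClass.hasPartialTrace (h : IsTraceClass X) : HasPartialTrace X (partialTrace X) := by
  obtain ⟨u, v, hr⟩ := h.exists_rep
  set K := fun i => tensorKet E (basis F i)
  have hs := summable_mul_of_bessel
    (a := fun i n => ‖ContinuousLinearMap.adjoint (K i) (u n)‖)
    (b := fun i n => ‖ContinuousLinearMap.adjoint (K i) (v n)‖)
    (fun _ _ => norm_nonneg _) (fun _ _ => norm_nonneg _) (fun n => norm_nonneg (u n))
    (fun n => norm_nonneg (v n))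
    (fun n S => sum_norm_adjoint_tensorKet_sq_le (basis F).orthonormal (u n) S)
    (fun n S => sum_norm_adjoint_tensorKet_sq_le (basis F).orthonormal (v n) S) hr.summable
  refine (Summable.of_norm_bounded hs.prod fun i => ?_).hasSum
  refine ContinuousLinearMap.opNorm_le_bound _
    (tsum_nonneg fun n => mul_nonneg (norm_nonneg _) (norm_nonneg _)) fun x => ?_
  rw [← ((hr.comp (ContinuousLinearMap.adjoint (K i)) (K i)).hasSum x).tsum_eq, ← tsum_mul_right]
  refine tsum_of_norm_bounded ((hs.prod_factor i).mul_right ‖x‖).hasSum fun n => ?_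
  rw [norm_smul, mul_right_comm]
  exact mul_le_mul_of_nonneg_right (norm_inner_le_norm _ _) (norm_nonneg _)

/-- Matrix elements of a partial trace are traces of the corresponding blocks. -/
theorem IsTraceClass.inner_partialTrace (h : IsTraceClass X) (φ ψ : E) :
    ⟪φ, partialTrace X ψ⟫_ℂ =
      trace (ContinuousLinearMap.adjoint (tensorKetLeft F φ) ∘L X ∘L tensorKetLeft F ψ) := by
  have h1 := (innerSL ℂ φ ∘L ContinuousLinearMap.apply ℂ E ψ).hasSum h.hasPartialTrace
  refine (HasSum.tsum_eq ?_).symm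
  simpa [Function.comp_def, ContinuousLinearMap.adjoint_inner_right] using h1

/-- The nuclear norm of a representation bounds all matrix elements of the partial trace, as these
are traces. -/
theorem IsNuclearRep.norm_partialTrace_mul_le {u v : ℕ → HTensor E F} (h : IsNuclearRep X u v)
    (L R : HTensor E F →L[ℂ] HTensor E F) :
    ‖partialTrace (L * X * R)‖ ≤ (∑' n, ‖u n‖ * ‖v n‖) * ‖L‖ * ‖R‖ := by
  have hν : 0 ≤ ∑' n, ‖u n‖ * ‖v n‖ := tsum_nonneg fun n => by positivity
  have hφ (φ : E) : ‖ContinuousLinearMap.adjoint (tensorKetLeft F φ) ∘L L‖ ≤ ‖φ‖ * ‖L‖ := by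
    refine (ContinuousLinearMap.opNorm_comp_le _ _).trans ?_
    rw [LinearIsometryEquiv.norm_map]
    exact mul_le_mul_of_nonneg_right (norm_tensorKetLeft_le φ) (norm_nonneg L)
  have hψ (ψ : E) : ‖R ∘L tensorKetLeft F ψ‖ ≤ ‖R‖ * ‖ψ‖ :=
    (ContinuousLinearMap.opNorm_comp_le _ _).trans
      (mul_le_mul_of_nonneg_left (norm_tensorKetLeft_le ψ) (norm_nonneg R))
  refine ContinuousLinearMap.opNorm_le_of_re_inner_le (by positivity) fun ψ φ hψ1 hφ1 => ?_
  refine (RCLike.re_le_norm _).trans ?_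
  rw [norm_inner_symm, ((h.isTraceClass.mul_left L).mul_right R).inner_partialTrace]
  refine (h.norm_trace_comp_le (ContinuousLinearMap.adjoint (tensorKetLeft F φ) ∘L L)
    (R ∘L tensorKetLeft F ψ)).trans ?_
  have h1 := hφ φ
  have h2 := hψ ψ
  rw [hφ1, one_mul] at h1
  rw [hψ1, mul_one] at h2
  gcongr

/-- The partial trace is cyclic for operators acting on the traced factor. -/
theorem IsTraceClass.partialTrace_mul_comm (h : IsTraceClass X) (C : F →L[ℂ] F) :
    partialTrace (X * tensorOp 1 C) = partialTrace (tensorOp 1 C * X) := by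
  ext ψ
  refine ext_inner_left ℂ fun φ => ?_
  rw [(h.mul_right _).inner_partialTrace, (h.mul_left _).inner_partialTrace]
  have h1 := ((h.comp (ContinuousLinearMap.adjoint (tensorKetLeft F φ))
    (tensorKetLeft F ψ))).trace_mul_comm C
  convert h1 using 2
  · simp only [ContinuousLinearMap.mul_def, ContinuousLinearMap.comp_assoc,
      tensorOp_comp_tensorKetLeft]
  · simp only [ContinuousLinearMap.mul_def, ← ContinuousLinearMap.comp_assoc,
      adjoint_tensorKetLeft_comp_tensorOp]

/-- For a trace class `X`, the bounded bilinear map `(L, R) ↦ Tr_F [L X R]`. -/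
def IsTraceClass.partialTraceL (h : IsTraceClass X) :
    (HTensor E F →L[ℂ] HTensor E F) →L[ℂ] (HTensor E F →L[ℂ] HTensor E F) →L[ℂ] E →L[ℂ] E :=
  LinearMap.mkContinuousOfExistsBound₂
    (LinearMap.mk₂ ℂ (fun L R => partialTrace (L * X * R))
      (fun L L' R => by
        rw [add_mul, add_mul]
        exact (((h.mul_left L).mul_right R).hasPartialTrace.add
          ((h.mul_left L').mul_right R).hasPartialTrace).eq)
      (fun c L R => by
        rw [smul_mul_assoc, smul_mul_assoc]
        exact (((h.mul_left L).mul_right R).hasPartialTrace.smul c).eq)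
      (fun L R R' => by
        rw [mul_add]
        exact (((h.mul_left L).mul_right R).hasPartialTrace.add
          ((h.mul_left L).mul_right R').hasPartialTrace).eq)
      (fun c L R => by
        rw [mul_smul_comm]
        exact (((h.mul_left L).mul_right R).hasPartialTrace.smul c).eq))
    (by
      obtain ⟨u, v, hr⟩ := h.exists_rep
      exact ⟨_, fun L R => hr.norm_partialTrace_mul_le L R⟩)

theorem IsTraceClass.partialTraceL_apply (h : IsTraceClass X)
    (L R : HTensor E F →L[ℂ] HTensor E F) : h.partialTraceL L R = partialTrace (L * X * R) := rfl

theorem IsTraceClass.hasPartialTrace_partialTraceL (h : IsTraceClass X)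
    (L R : HTensor E F →L[ℂ] HTensor E F) :
    HasPartialTrace (L * X * R) (h.partialTraceL L R) :=
  ((h.mul_left L).mul_right R).hasPartialTrace

/-- The partial trace of a product operator; the first factor need not be trace class. -/
theorem hasPartialTrace_tensorOp (A : E →L[ℂ] E) {η : F →L[ℂ] F} (hη : IsTraceClass η) :
    HasPartialTrace (tensorOp A η) (trace η • A) := by
  refine (hη.hasSum_trace.smul_const A).congr_fun fun i => ?_
  ext x
  simp [adjoint_tensorKet_tmul]

end PartialTrace

/-! ### The second-order reduced equation in a Banach algebra -/

section Reduced

variable {𝔸 𝔹 : Type*} [NormedRing 𝔸] [NormedAlgebra ℂ 𝔸]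
  [NormedAddCommGroup 𝔹] [NormedSpace ℂ 𝔹]

/-- The interaction picture `e^{i t H₀} X e^{-i t H₀}` of an element of a Banach algebra. -/
def rotate (H₀ X : 𝔸) (t : ℝ) : 𝔸 := evolution H₀ t * X * evolution H₀ (-t)

/-- The interaction picture propagator `e^{i t H₀} e^{-i t H}`. -/
def propagator (H₀ H : 𝔸) (t : ℝ) : 𝔸 := evolution H₀ t * evolution H (-t)

/-- The inverse `e^{i t H} e^{-i t H₀}` of the interaction picture propagator. -/
def propagatorInv (H₀ H : 𝔸) (t : ℝ) : 𝔸 := evolution H t * evolution H₀ (-t)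

/-- For `B (L, R) = Φ (L ρ R)` with a fixed `ρ`, the value `Φ [a, [b, L ρ R]]`. -/
def doubleCommutator (B : 𝔸 →L[ℂ] 𝔸 →L[ℂ] 𝔹) (a b L R : 𝔸) : 𝔹 :=
  (B (a * b * L) R - B (a * L) (R * b)) - (B (b * L) (R * a) - B L (R * b * a))

theorem continuous_doubleCommutator {α : Type*} [TopologicalSpace α] (B : 𝔸 →L[ℂ] 𝔸 →L[ℂ] 𝔹)
    (a : 𝔸) {b L R : α → 𝔸} (hb : Continuous b) (hL : Continuous L) (hR : Continuous R) :
    Continuous fun s => doubleCommutator B a (b s) (L s) (R s) := by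
  unfold doubleCommutator; fun_prop

variable [CompleteSpace 𝔸]

@[fun_prop] theorem continuous_rotate (H₀ X : 𝔸) : Continuous (rotate H₀ X) := by
  unfold rotate; fun_prop

@[fun_prop] theorem continuous_propagator (H₀ H : 𝔸) : Continuous (propagator H₀ H) := by
  unfold propagator; fun_prop

@[fun_prop] theorem continuous_propagatorInv (H₀ H : 𝔸) : Continuous (propagatorInv H₀ H) := by
  unfold propagatorInv; fun_prop

theorem hasDerivAt_propagator (H₀ HI : 𝔸) (t : ℝ) :
    HasDerivAt (propagator H₀ (HI + H₀))
      (-Complex.I • (rotate H₀ HI t * propagator H₀ (HI + H₀) t)) t := by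
  refine ((hasDerivAt_evolution H₀ t).mul (hasDerivAt_evolution_neg (HI + H₀) t)).congr_deriv ?_
  simp only [rotate, propagator, smul_mul_assoc, mul_smul_comm, mul_assoc, add_mul, mul_add,
    evolution_neg_mul_cancel, neg_smul, mul_neg, smul_add]
  abel

theorem hasDerivAt_propagatorInv (H₀ HI : 𝔸) (t : ℝ) :
    HasDerivAt (propagatorInv H₀ (HI + H₀))
      (Complex.I • (propagatorInv H₀ (HI + H₀) t * rotate H₀ HI t)) t := by
  refine ((hasDerivAt_evolution (HI + H₀) t).mul (hasDerivAt_evolution_neg H₀ t)).congr_deriv ?_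
  simp only [rotate, propagatorInv, smul_mul_assoc, mul_smul_comm, mul_assoc, add_mul, mul_add,
    evolution_neg_mul_cancel, neg_smul, mul_neg, smul_add]
  abel

variable [CompleteSpace 𝔹]

/-- The exact second-order equation for a reduced state. Here `B (L, R)` stands for the reduction
of `L ρ(0) R`; the free evolution is invisible after reduction. The derivative at time `t` is the
reduced commutator of the interaction with the state, which is integrated once more over `[0, t]`
in the interaction picture. -/
theorem hasDerivAt_reduced (B : 𝔸 →L[ℂ] 𝔸 →L[ℂ] 𝔹) (H₀ HI : 𝔸)
    (hB : ∀ L R, B (H₀ * L) R = B L (R * H₀))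
    (hBe : ∀ L R s, B (evolution H₀ s * L) R = B L (R * evolution H₀ s)) (t : ℝ) :
    HasDerivAt (fun τ => B (evolution (HI + H₀) (-τ)) (evolution (HI + H₀) τ))
      (-Complex.I • (B (rotate H₀ HI t) 1 - B 1 (rotate H₀ HI t))
        - ∫ s in (0 : ℝ)..t, doubleCommutator B (rotate H₀ HI t) (rotate H₀ HI s)
            (propagator H₀ (HI + H₀) s) (propagatorInv H₀ (HI + H₀) s)) t := by
  set H := HI + H₀ with hH
  set a := rotate H₀ HI t with ha
  set V := propagator H₀ H with hV
  set W := propagatorInv H₀ H with hW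
  set G := fun s => doubleCommutator B a (rotate H₀ HI s) (V s) (W s) with hG
  set F := fun s => B (a * V s) (W s) - B (V s) (W s * a) with hF
  have hbil {u v : ℝ → 𝔸} {u' v' : 𝔸} {s : ℝ} (hu : HasDerivAt u u' s) (hv : HasDerivAt v v' s) :
      HasDerivAt (fun x => B (u x) (v x)) (B (u s) v' + B u' (v s)) s :=
    (ContinuousLinearMap.bilinearRestrictScalars ℝ B).hasDerivAt_of_bilinear
      (fun _ => hu) (fun _ => hv)
  have hFd (s : ℝ) : HasDerivAt F (-Complex.I • G s) s := by
    have hVd := hasDerivAt_propagator H₀ HI s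
    have hWd := hasDerivAt_propagatorInv H₀ HI s
    rw [← hH, ← hV] at hVd
    rw [← hH, ← hW] at hWd
    refine ((hbil (hVd.const_mul a) hWd).sub (hbil hVd (hWd.mul_const a))).congr_deriv ?_
    simp only [hG, doubleCommutator, map_smul, smul_apply, mul_smul_comm, smul_mul_assoc, neg_smul,
      map_neg, neg_apply, mul_neg, smul_sub, mul_assoc]
    abel
  have hGc : Continuous G :=
    continuous_doubleCommutator B a (continuous_rotate H₀ HI) (continuous_propagator H₀ H)
      (continuous_propagatorInv H₀ H)
  have hFTC : F t - F 0 = -Complex.I • ∫ s in (0 : ℝ)..t, G s := by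
    rw [← intervalIntegral.integral_smul]
    exact (intervalIntegral.integral_eq_sub_of_hasDerivAt (fun s _ => hFd s)
      ((hGc.const_smul _).intervalIntegrable _ _)).symm
  have hF0 : F 0 = B a 1 - B 1 a := by
    simp [hF, hV, hW, propagator, propagatorInv]
  -- At `s = t` the free evolution drops out by cyclicity.
  have hFt : F t = B (HI * evolution H (-t)) (evolution H t)
      - B (evolution H (-t)) (evolution H t * HI) := by
    simp only [hF, ha, hV, hW, propagator, propagatorInv, rotate, mul_assoc,
      evolution_neg_mul_cancel, hBe]
    simp
  refine (hbil (hasDerivAt_evolution_neg H t) (hasDerivAt_evolution H t)).congr_deriv ?_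
  have hkey : B (evolution H (-t)) (Complex.I • (evolution H t * H))
      + B (-Complex.I • (H * evolution H (-t))) (evolution H t) = -Complex.I • F t := by
    -- The free part of the Hamiltonian does not contribute to the reduced commutator.
    have hz (L R : 𝔸) : B L (Complex.I • (R * (HI + H₀))) + B (-Complex.I • ((HI + H₀) * L)) R
        = -Complex.I • (B (HI * L) R - B L (R * HI)) := by
      simp only [map_smul, smul_apply, add_mul, mul_add, map_add, add_apply, hB, neg_smul, smul_add,
        smul_sub, map_neg, neg_apply]
      abel
    rw [hFt]
    exact hz _ _
  rw [hkey, sub_eq_iff_eq_add.1 hFTC, hF0, smul_add, smul_smul]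
  simp only [neg_mul_neg, Complex.I_mul_I, neg_smul, one_smul]
  abel

end Reduced

/-! ### The memory kernel as a partial trace -/

section Kernel

theorem interactionPicture_eq_rotate {E : Type*} [NormedAddCommGroup E] [InnerProductSpace ℂ E]
    (H₀ X : E →L[ℂ] E) (t : ℝ) : interactionPicture H₀ t X = rotate H₀ X t := by
  simp [interactionPicture, rotate, evolution]

theorem lie_lie_sub_ring {𝔸 : Type*} [Ring 𝔸] (a b x y : 𝔸) :
    ⁅a, ⁅b, x - y⁆⁆ = ⁅a, ⁅b, x⁆⁆ - ⁅a, ⁅b, y⁆⁆ := by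
  simp only [Ring.lie_def, mul_sub, sub_mul]
  abel

theorem lie_lie_sum_sum {𝔸 ι κ : Type*} [Ring 𝔸] [Fintype ι] [Fintype κ] (a b : 𝔸) (y : ι → κ → 𝔸) :
    ⁅a, ⁅b, ∑ l, ∑ m, y l m⁆⁆ = ∑ l, ∑ m, ⁅a, ⁅b, y l m⁆⁆ := by
  simp only [Ring.lie_def, Finset.mul_sum, Finset.sum_mul, Finset.sum_sub_distrib, mul_sub, sub_mul]

section Banach

variable {𝔸 : Type*} [NormedRing 𝔸] [NormedAlgebra ℂ 𝔸]

theorem evolution_smul (c : ℝ) (a : 𝔸) (t : ℝ) :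
    evolution ((c : ℂ) • a) t = evolution a (c * t) := by
  rw [evolution, evolution, smul_smul]
  push_cast
  ring_nf

theorem rotate_smul (H₀ X : 𝔸) (c : ℂ) (t : ℝ) : rotate H₀ (c • X) t = c • rotate H₀ X t := by
  simp [rotate]

theorem rotate_sub (H₀ X Y : 𝔸) (t : ℝ) :
    rotate H₀ (X - Y) t = rotate H₀ X t - rotate H₀ Y t := by
  simp [rotate, mul_sub, sub_mul]

theorem rotate_sum {ι : Type*} (S : Finset ι) (H₀ : 𝔸) (X : ι → 𝔸) (t : ℝ) :
    rotate H₀ (∑ i ∈ S, X i) t = ∑ i ∈ S, rotate H₀ (X i) t := by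
  simp [rotate, Finset.mul_sum, Finset.sum_mul]

theorem smul_sum_smul_mul_of_ne {ι : Type*} [Fintype ι] {P : ι → 𝔸} {Q : 𝔸} {l : ι} (c : ℂ)
    (d : ι → ℂ) (h : ∀ k, k ≠ l → P k * Q = 0) :
    (c • ∑ k, d k • P k) * Q = (c * d l) • (P l * Q) := by
  rw [smul_mul_assoc, Finset.sum_mul, Finset.sum_eq_single l, smul_mul_assoc, smul_smul]
  · intro k _ hk
    rw [smul_mul_assoc, h k hk, smul_zero]
  · simp

theorem mul_smul_sum_smul_of_ne {ι : Type*} [Fintype ι] {P : ι → 𝔸} {Q : 𝔸} {l : ι} (c : ℂ)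
    (d : ι → ℂ) (h : ∀ k, k ≠ l → Q * P k = 0) :
    Q * (c • ∑ k, d k • P k) = (c * d l) • (Q * P l) := by
  rw [mul_smul_comm, Finset.mul_sum, Finset.sum_eq_single l, mul_smul_comm, smul_smul]
  · intro k _ hk
    rw [mul_smul_comm, h k hk, smul_zero]
  · simp

theorem lie_smul_sum_lie_smul_sum {ι : Type*} [Fintype ι] (c : ℂ) (a b : ι → 𝔸) (y : 𝔸) :
    ⁅c • ∑ α, a α, ⁅c • ∑ β, b β, y⁆⁆ = ∑ α, ∑ β, (c * c) •
      ((a α * (b β * y) - a α * (y * b β)) - ((b β * y) * a α - (y * b β) * a α)) := by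
  simp only [Ring.lie_def, smul_mul_assoc, mul_smul_comm, ← smul_sub, smul_smul,
    ← Finset.smul_sum]
  congr 1
  simp only [Finset.sum_sub_distrib, ← Finset.mul_sum, ← Finset.sum_mul, mul_sub, sub_mul]

end Banach

variable {E F : Type*} [NormedAddCommGroup E] [InnerProductSpace ℂ E]
  [NormedAddCommGroup F] [InnerProductSpace ℂ F]

@[simp] theorem tensorOp_zero_left (B : F →L[ℂ] F) : tensorOp (0 : E →L[ℂ] E) B = 0 := by
  simpa using tensorOp_smul_left 0 (0 : E →L[ℂ] E) B

variable [CompleteSpace F]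

theorem continuous_tensorOp_one_evolution (B : F →L[ℂ] F) :
    Continuous fun t => tensorOp (1 : E →L[ℂ] E) (evolution B t) := by
  simp only [tensorOp_one_evolution]
  fun_prop

theorem IsTraceClass.continuous_trace_mul_mul_mul {η : F →L[ℂ] F} (hη : IsTraceClass η)
    {P Q R : ℝ → (F →L[ℂ] F)} (hP : Continuous P) (hQ : Continuous Q) (hR : Continuous R) :
    Continuous fun s => trace (P s * Q s * (R s * η)) := by
  simp only [← mul_assoc]
  exact hη.continuous_trace_mul ((hP.mul hQ).mul hR)

theorem rotate_tensorOp (G : F →L[ℂ] F) (A : E →L[ℂ] E) (B : F →L[ℂ] F) (t : ℝ) :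
    rotate (tensorOp (1 : E →L[ℂ] E) G) (tensorOp A B) t = tensorOp A (rotate G B t) := by
  simp only [rotate, ← tensorOp_one_evolution, tensorOp_mul, one_mul, mul_one]

/-- The partial trace of a double commutator of interactions with a product state. The four
orderings are brought to the form `Tr [B B' η]` by cyclicity of the trace, and two of them are
relabelled. -/
theorem hasPartialTrace_doubleCommutator [CompleteSpace E] {ι : Type*} [Fintype ι] (c : ℂ)
    (A : ι → (E →L[ℂ] E)) (B B' : ι → (F →L[ℂ] F)) (X : E →L[ℂ] E) {η : F →L[ℂ] F}
    (hη : IsTraceClass η) :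
    HasPartialTrace ⁅c • ∑ α, tensorOp (A α) (B α), ⁅c • ∑ α, tensorOp (A α) (B' α), tensorOp X η⁆⁆
      (∑ α, ∑ β, ((c * c * trace (B α * B' β * η)) • (A α * A β * X - A β * X * A α)
        + (c * c * trace (B' α * B β * η)) • (X * A α * A β - A β * X * A α))) := by
  have hexp : ⁅c • ∑ α, tensorOp (A α) (B α), ⁅c • ∑ α, tensorOp (A α) (B' α), tensorOp X η⁆⁆ =
      ∑ α, ∑ β, (c * c) • ((tensorOp (A α * (A β * X)) (B α * (B' β * η))
        - tensorOp (A α * (X * A β)) (B α * (η * B' β)))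
        - (tensorOp (A β * X * A α) (B' β * η * B α)
        - tensorOp (X * A β * A α) (η * B' β * B α))) := by
    refine (lie_smul_sum_lie_smul_sum c (fun α => tensorOp (A α) (B α))
      (fun α => tensorOp (A α) (B' α)) (tensorOp X η)).trans ?_
    simp only [tensorOp_mul]
  have hc : ∀ P Q, trace (P * η * Q) = trace (Q * P * η) := fun P Q => by
    rw [(hη.mul_left P).trace_mul_comm, mul_assoc]
  have hc' : ∀ P Q, trace (η * P * Q) = trace (P * Q * η) := fun P Q => by
    rw [mul_assoc, hη.trace_mul_comm]
  rw [hexp]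
  have h := HasPartialTrace.sum (s := Finset.univ) fun α _ =>
    HasPartialTrace.sum (s := Finset.univ) fun β _ =>
      (((hasPartialTrace_tensorOp (A α * (A β * X)) ((hη.mul_left (B' β)).mul_left (B α))).sub
        (hasPartialTrace_tensorOp (A α * (X * A β))
          ((hη.mul_right (B' β)).mul_left (B α)))).sub
        ((hasPartialTrace_tensorOp (A β * X * A α)
          ((hη.mul_left (B' β)).mul_right (B α))).sub
        (hasPartialTrace_tensorOp (X * A β * A α)
          ((hη.mul_right (B' β)).mul_right (B α))))).smul (c * c)
  convert h using 1
  simp only [← mul_assoc, hc, hc']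
  -- The names `α` and `β` are exchanged in the second half of the sum.
  have hsplit : ∀ f g : ι → ι → (E →L[ℂ] E), ∑ α, ∑ β, (f α β + g α β) =
      ∑ α, ∑ β, (f α β + g β α) := fun f g => by
    simp only [Finset.sum_add_distrib]
    rw [Finset.sum_comm (f := fun α β => g α β)]
  rw [hsplit]
  refine Finset.sum_congr rfl fun α _ => Finset.sum_congr rfl fun β _ => ?_
  simp only [smul_sub, mul_smul]
  abel

end Kernel

/-! ### The environment -/

section Environment

theorem inner_single_single {K : ℕ} (j l : Fin K) :
    ⟪EuclideanSpace.single j (1 : ℂ), EuclideanSpace.single l (1 : ℂ)⟫_ℂ =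
      if j = l then 1 else 0 := by
  simp [EuclideanSpace.inner_single_left]

theorem ketbra_mul_ketbra {K : ℕ} (i j l m : Fin K) :
    ketbra i j * ketbra l m = if j = l then ketbra i m else 0 := by
  ext x : 1
  by_cases h : j = l <;> simp [ketbra, inner_single_single, h]

variable {K : ℕ} {𝒦 : Set ℝ} {γ : ℝ} {H' ρB : L2 𝒦 →L[ℂ] L2 𝒦}

theorem hamEnv_mul_tensorOp (l m : Fin K) :
    hamEnv K γ H' * tensorOp (ketbra l m) 1 =
      tensorOp (ketbra l m) 1 * tensorOp 1 (((γ * level l : ℝ) : ℂ) • H') := by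
  refine (smul_sum_smul_mul_of_ne (P := fun k => tensorOp (ketbra k k) H')
    (Q := tensorOp (ketbra l m) 1) (l := l) (γ : ℂ) (fun k => (level k : ℂ))
    fun k hk => ?_).trans ?_
  · rw [tensorOp_mul, ketbra_mul_ketbra, if_neg hk, tensorOp_zero_left]
  · rw [tensorOp_mul, tensorOp_mul, ketbra_mul_ketbra, if_pos rfl, mul_one, mul_one, one_mul,
      tensorOp_smul_right, Complex.ofReal_mul]

theorem tensorOp_mul_hamEnv (l m : Fin K) :
    tensorOp (ketbra l m) 1 * hamEnv K γ H' =
      tensorOp 1 (((γ * level m : ℝ) : ℂ) • H') * tensorOp (ketbra l m) 1 := by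
  refine (mul_smul_sum_smul_of_ne (P := fun k => tensorOp (ketbra k k) H')
    (Q := tensorOp (ketbra l m) 1) (l := m) (γ : ℂ) (fun k => (level k : ℂ))
    fun k hk => ?_).trans ?_
  · rw [tensorOp_mul, ketbra_mul_ketbra, if_neg hk.symm, tensorOp_zero_left]
  · rw [tensorOp_mul, tensorOp_mul, ketbra_mul_ketbra, if_pos rfl, mul_one, one_mul, one_mul,
      tensorOp_smul_right, Complex.ofReal_mul]

/-- A matrix unit intertwines the environment evolution with the evolutions of `H'` at the speeds
of the two levels; a stationary bath state absorbs both into one exponential. -/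
theorem rotate_hamEnv_tensorOp (hstat : ⁅H', ρB⁆ = 0) (l m : Fin K) (c : ℂ) (s : ℝ) :
    rotate (hamEnv K γ H') (tensorOp (c • ketbra l m) ρB) s = envStateI γ H' ρB l m c s := by
  have hl : evolution (hamEnv K γ H') s * tensorOp (ketbra l m) 1 =
      tensorOp (ketbra l m) 1 * tensorOp 1 (evolution H' (γ * level l * s)) := by
    have h : SemiconjBy (tensorOp (ketbra l m) 1)
        (tensorOp 1 (((γ * level l : ℝ) : ℂ) • H')) (hamEnv K γ H') :=
      (hamEnv_mul_tensorOp l m).symm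
    rw [← evolution_smul, tensorOp_one_evolution]
    exact (semiconjBy_evolution h s).eq.symm
  have hm : tensorOp (ketbra l m) 1 * evolution (hamEnv K γ H') (-s) =
      tensorOp 1 (evolution H' (γ * level m * -s)) * tensorOp (ketbra l m) 1 := by
    have h : SemiconjBy (tensorOp (ketbra l m) 1) (hamEnv K γ H')
        (tensorOp 1 (((γ * level m : ℝ) : ℂ) • H')) := tensorOp_mul_hamEnv l m
    rw [← evolution_smul, tensorOp_one_evolution]
    exact (semiconjBy_evolution h (-s)).eq
  have hcomm : Commute ρB (evolution H' (γ * level m * -s)) := by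
    have h : Commute ρB H' := (sub_eq_zero.1 hstat).symm
    exact semiconjBy_evolution h _
  rw [tensorOp_smul_left, rotate_smul, envStateI, tensorOp_smul_left]
  congr 1
  have h1 : tensorOp (ketbra l m) ρB = tensorOp (ketbra l m) 1 * tensorOp 1 ρB := by
    rw [tensorOp_mul, mul_one, one_mul]
  rw [rotate, h1, ← mul_assoc, hl, mul_assoc (tensorOp (ketbra l m) 1), tensorOp_mul, tensorOp_mul]
  rw [one_mul, one_mul, mul_one, ← one_mul (ketbra l m),
    ← mul_one (evolution H' (γ * level l * s) * ρB), ← tensorOp_mul, mul_assoc, hm, tensorOp_mul,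
    tensorOp_mul]
  simp only [one_mul, mul_one]
  rw [mul_assoc, hcomm.eq, ← mul_assoc, ← evolution_add,
    show γ * level l * s + γ * level m * -s = γ * (level l - level m) * s by ring, evolution]

theorem tensorOp_ketbra (l m : Fin K) (η : L2 𝒦 →L[ℂ] L2 𝒦) :
    tensorOp (ketbra l m) η = tensorKetLeft (L2 𝒦) (EuclideanSpace.single l (1 : ℂ)) ∘L η ∘L
      ContinuousLinearMap.adjoint (tensorKetLeft (L2 𝒦) (EuclideanSpace.single m (1 : ℂ))) := by
  refine ext_tmul fun x y => ?_
  have h : ContinuousLinearMap.adjoint (tensorKetLeft (L2 𝒦) (EuclideanSpace.single m (1 : ℂ)))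
      (tmul x y) = ⟪EuclideanSpace.single m (1 : ℂ), x⟫_ℂ • y := by
    refine ext_inner_right ℂ fun y' => ?_
    rw [ContinuousLinearMap.adjoint_inner_left, tensorKetLeft_apply, inner_tmul, inner_smul_left,
      inner_conj_symm]
  rw [tensorOp_tmul, ContinuousLinearMap.comp_apply, ContinuousLinearMap.comp_apply, h, map_smul,
    map_smul, tensorKetLeft_apply, ketbra, InnerProductSpace.rankOne_apply, tmul_smul_left]

theorem isTraceClass_tensorOp_ketbra (h : IsTraceClass ρB) (l m : Fin K) :
    IsTraceClass (tensorOp (ketbra l m) ρB) := by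
  rw [tensorOp_ketbra]
  exact h.comp _ _

theorem envStateI_eq_smul (l m : Fin K) (c : ℂ) (s : ℝ) :
    envStateI γ H' ρB l m c s = c • (tensorOp 1 (evolution H' (γ * (level l - level m) * s)) *
      tensorOp (ketbra l m) ρB) := by
  rw [envStateI, tensorOp_smul_left, tensorOp_mul, one_mul, evolution]

theorem isTraceClass_envStateI (h : IsTraceClass ρB) (l m : Fin K) (c : ℂ) (s : ℝ) :
    IsTraceClass (envStateI γ H' ρB l m c s) := by
  rw [envStateI_eq_smul, ← smul_mul_assoc]
  exact (isTraceClass_tensorOp_ketbra h l m).mul_left _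

end Environment

/-! ### The Born form of the state -/

section Born

variable {Hm : Type*} [NormedAddCommGroup Hm] [InnerProductSpace ℂ Hm] {K : ℕ} {𝒦 : Set ℝ}
  {κ γ : ℝ} {A : Dir → (Hm →L[ℂ] Hm)} {H' ρB : L2 𝒦 →L[ℂ] L2 𝒦} {r : Fin K → Fin K → ℝ → ℂ}
  {ρlm : Fin K → Fin K → ℝ → (Hm →L[ℂ] Hm)}

theorem hamIntI_eq (t : ℝ) : hamIntI K κ γ A H' t =
    (Real.sqrt (κ * γ) : ℂ) • ∑ α : Dir, tensorOp (A α) (opBI K γ H' α t) := by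
  simp only [hamIntI, interactionPicture_eq_rotate, hamInt, rotate_smul, rotate_sum, hamFree,
    rotate_tensorOp, opBI]

theorem rotate_bornState (hstat : ⁅H', ρB⁆ = 0) (s : ℝ) :
    rotate (hamFree Hm K γ H') (bornState ρB r ρlm s) s =
      ∑ l, ∑ m, tensorOp (ρlm l m s) (envStateI γ H' ρB l m (r l m s) s) := by
  simp only [bornState, rotate_sum, hamFree, rotate_tensorOp, rotate_hamEnv_tensorOp hstat]

/-- The memory kernel is the second-order term of the state in Born form. -/
theorem hasPartialTrace_memoryKernel [CompleteSpace Hm] (hκγ : 0 ≤ κ * γ) (hρB : IsTraceClass ρB)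
    (hstat : ⁅H', ρB⁆ = 0) (t s : ℝ) :
    HasPartialTrace ⁅hamIntI K κ γ A H' t, ⁅hamIntI K κ γ A H' s,
      rotate (hamFree Hm K γ H') (bornState ρB r ρlm s) s⁆⁆
      (memoryKernel κ γ A H' ρB r ρlm t s) := by
  have hsq : (Real.sqrt (κ * γ) : ℂ) * (Real.sqrt (κ * γ) : ℂ) = ((κ * γ : ℝ) : ℂ) := by
    rw [← Complex.ofReal_mul, Real.mul_self_sqrt hκγ]
  rw [rotate_bornState hstat, hamIntI_eq, hamIntI_eq]
  refine Eq.mpr (congrArg (fun Z => HasPartialTrace Z _) (lie_lie_sum_sum _ _ _)) ?_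
  refine HasPartialTrace.sum fun l _ => HasPartialTrace.sum fun m _ => ?_
  have h := hasPartialTrace_doubleCommutator (Real.sqrt (κ * γ) : ℂ) A
    (fun α => opBI K γ H' α t) (fun α => opBI K γ H' α s) (ρlm l m s)
    (isTraceClass_envStateI (γ := γ) (H' := H') hρB l m (r l m s) s)
  rw [hsq] at h
  exact h

/-- The memory kernel depends on the state coefficients only through the products `r_{lm} ρ^{lm}`,
with continuous weights. -/
theorem continuousOn_memoryKernel (hρB : IsTraceClass ρB) {S : Set ℝ}
    (hr : ∀ l m, ContinuousOn (fun s => r l m s • ρlm l m s) S) (t : ℝ) :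
    ContinuousOn (memoryKernel κ γ A H' ρB r ρlm t) S := by
  have hB (α : Dir) : Continuous (opBI K γ H' α) := by
    have h : opBI K γ H' α = rotate (hamEnv K γ H') (opB K 𝒦 α) :=
      funext fun t => interactionPicture_eq_rotate _ _ _
    rw [h]
    exact continuous_rotate _ _
  have htr (l m : Fin K) {P Q : ℝ → (Env K 𝒦 →L[ℂ] Env K 𝒦)} (hP : Continuous P)
      (hQ : Continuous Q) : Continuous fun s => ((κ * γ : ℝ) : ℂ) *
        trace (P s * Q s * envStateI γ H' ρB l m 1 s) := by
    simp only [envStateI_eq_smul, one_smul]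
    exact continuous_const.mul ((isTraceClass_tensorOp_ketbra hρB l m).continuous_trace_mul_mul_mul
      hP hQ ((continuous_tensorOp_one_evolution H').comp
        (continuous_const.mul continuous_id)))
  -- The scalar `r_{lm}(s)` moves from the environment factor to the market factor.
  have hterm (l m : Fin K) (P Q : ℝ → (Env K 𝒦 →L[ℂ] Env K 𝒦)) (s : ℝ) (Z : Hm →L[ℂ] Hm) :
      (((κ * γ : ℝ) : ℂ) * trace (P s * Q s * envStateI γ H' ρB l m (r l m s) s)) • Z =
      (((κ * γ : ℝ) : ℂ) * trace (P s * Q s * envStateI γ H' ρB l m 1 s)) • r l m s • Z := by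
    rw [envStateI_eq_smul, envStateI_eq_smul, one_smul, mul_smul_comm, trace_smul, smul_smul]
    ring_nf
  refine continuousOn_finsetSum _ fun l _ => continuousOn_finsetSum _ fun m _ =>
    continuousOn_finsetSum _ fun α _ => continuousOn_finsetSum _ fun β _ => ContinuousOn.add ?_ ?_
  · have h : ContinuousOn (fun s => (((κ * γ : ℝ) : ℂ) *
        trace (opBI K γ H' α t * opBI K γ H' β s * envStateI γ H' ρB l m 1 s)) •
        (A α * A β * (r l m s • ρlm l m s) - A β * (r l m s • ρlm l m s) * A α)) S :=
      (htr l m continuous_const (hB β)).continuousOn.smul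
        ((continuousOn_const.mul (hr l m)).sub
          ((continuousOn_const.mul (hr l m)).mul continuousOn_const))
    refine h.congr fun s _ => ?_
    simp only [corrF]
    rw [hterm l m (fun _ => opBI K γ H' α t) (fun s => opBI K γ H' β s)]
    simp only [mul_smul_comm, smul_mul_assoc, smul_sub]
  · have h : ContinuousOn (fun s => (((κ * γ : ℝ) : ℂ) *
        trace (opBI K γ H' α s * opBI K γ H' β t * envStateI γ H' ρB l m 1 s)) •
        ((r l m s • ρlm l m s) * A α * A β - A β * (r l m s • ρlm l m s) * A α)) S :=
      (htr l m (hB α) continuous_const).continuousOn.smul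
        ((((hr l m).mul continuousOn_const).mul continuousOn_const).sub
          ((continuousOn_const.mul (hr l m)).mul continuousOn_const))
    refine h.congr fun s _ => ?_
    simp only [corrG]
    rw [hterm l m (fun s => opBI K γ H' α s) (fun _ => opBI K γ H' β t)]
    simp only [mul_smul_comm, smul_mul_assoc, smul_sub]

end Born

/-! ### The exact reduced dynamics -/

section Dynamics

variable {E F : Type*} [NormedAddCommGroup E] [InnerProductSpace ℂ E] [CompleteSpace E]
  [NormedAddCommGroup F] [InnerProductSpace ℂ F] [CompleteSpace F]
  {X : HTensor E F →L[ℂ] HTensor E F}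

theorem IsTraceClass.partialTraceL_tensorOp (h : IsTraceClass X) (C : F →L[ℂ] F)
    (L R : HTensor E F →L[ℂ] HTensor E F) :
    h.partialTraceL (tensorOp 1 C * L) R = h.partialTraceL L (R * tensorOp 1 C) := by
  have h1 := ((h.mul_left L).mul_right R).partialTrace_mul_comm C
  rw [h.partialTraceL_apply, h.partialTraceL_apply, ← mul_assoc, h1]
  simp only [mul_assoc]

theorem IsTraceClass.hasPartialTrace_lie (h : IsTraceClass X)
    (a : HTensor E F →L[ℂ] HTensor E F) :
    HasPartialTrace ⁅a, X⁆ (h.partialTraceL a 1 - h.partialTraceL 1 a) := by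
  have h1 := (h.hasPartialTrace_partialTraceL a 1).sub (h.hasPartialTrace_partialTraceL 1 a)
  simpa [Ring.lie_def] using h1

theorem IsTraceClass.hasPartialTrace_lie_lie (h : IsTraceClass X)
    (a b L R : HTensor E F →L[ℂ] HTensor E F) :
    HasPartialTrace ⁅a, ⁅b, L * X * R⁆⁆ (doubleCommutator h.partialTraceL a b L R) := by
  have h1 := ((h.hasPartialTrace_partialTraceL (a * b * L) R).sub
    (h.hasPartialTrace_partialTraceL (a * L) (R * b))).sub
    ((h.hasPartialTrace_partialTraceL (b * L) (R * a)).sub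
    (h.hasPartialTrace_partialTraceL L (R * b * a)))
  simpa [Ring.lie_def, mul_sub, sub_mul, mul_assoc, doubleCommutator] using h1

theorem HasPartialTrace.lie_lie_rotate_sub {a b G Y Z : HTensor E F →L[ℂ] HTensor E F}
    {S T : E →L[ℂ] E} {s : ℝ} (hY : HasPartialTrace ⁅a, ⁅b, rotate G Y s⁆⁆ S)
    (hZ : HasPartialTrace ⁅a, ⁅b, rotate G Z s⁆⁆ T) :
    HasPartialTrace ⁅a, ⁅b, rotate G (Y - Z) s⁆⁆ (S - T) := by
  rw [rotate_sub, lie_lie_sub_ring]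
  exact hY.sub hZ

/-- The reduced second-order equation for a solution of the von Neumann equation whose free
Hamiltonian acts on the traced factor only. The integrand is the partial trace of the double
commutator with the interaction picture state. -/
theorem hasDerivWithinAt_partialTrace {ρ : ℝ → (HTensor E F →L[ℂ] HTensor E F)} {G : F →L[ℂ] F}
    {HI : HTensor E F →L[ℂ] HTensor E F} (h0 : IsTraceClass (ρ 0))
    (hρ : IsVonNeumannSolution (HI + tensorOp 1 G) ρ) {t : ℝ} (ht : 0 ≤ t) :
    ∃ g : ℝ → (E →L[ℂ] E), Continuous g ∧
      (∀ s, 0 ≤ s → HasPartialTrace ⁅rotate (tensorOp 1 G) HI t, ⁅rotate (tensorOp 1 G) HI s,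
        rotate (tensorOp 1 G) (ρ s) s⁆⁆ (g s)) ∧
      HasDerivWithinAt (fun τ => partialTrace (ρ τ))
        (-Complex.I • partialTrace ⁅rotate (tensorOp 1 G) HI t, ρ 0⁆ - ∫ s in (0 : ℝ)..t, g s)
        (Set.Ici 0) t := by
  set H₀ : HTensor E F →L[ℂ] HTensor E F := tensorOp 1 G with hH₀
  have hsol : ∀ s, 0 ≤ s → ρ s = evolution (HI + H₀) (-s) * ρ 0 * evolution (HI + H₀) s :=
    fun s hs => eq_evolution_of_hasDerivWithinAt hρ hs
  refine ⟨fun s => doubleCommutator h0.partialTraceL (rotate H₀ HI t) (rotate H₀ HI s)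
    (propagator H₀ (HI + H₀) s) (propagatorInv H₀ (HI + H₀) s), ?_, fun s hs => ?_, ?_⟩
  · exact continuous_doubleCommutator _ _ (continuous_rotate _ _) (continuous_propagator _ _)
      (continuous_propagatorInv _ _)
  · have h1 : rotate H₀ (ρ s) s =
        propagator H₀ (HI + H₀) s * ρ 0 * propagatorInv H₀ (HI + H₀) s := by
      rw [rotate, hsol s hs, propagator, propagatorInv]
      simp only [mul_assoc]
    rw [h1]
    exact h0.hasPartialTrace_lie_lie _ _ _ _
  · rw [(h0.hasPartialTrace_lie (rotate H₀ HI t)).eq]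
    have hcyc (L R : HTensor E F →L[ℂ] HTensor E F) (s : ℝ) :
        h0.partialTraceL (evolution H₀ s * L) R = h0.partialTraceL L (R * evolution H₀ s) := by
      rw [hH₀, ← tensorOp_one_evolution]
      exact h0.partialTraceL_tensorOp _ _ _
    have hd := hasDerivAt_reduced (𝔸 := HTensor E F →L[ℂ] HTensor E F) (𝔹 := E →L[ℂ] E)
      h0.partialTraceL H₀ HI (h0.partialTraceL_tensorOp G) hcyc t
    refine hd.hasDerivWithinAt.congr (fun s hs => ?_) ?_
    · rw [hsol s hs, h0.partialTraceL_apply]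
    · rw [hsol t ht, h0.partialTraceL_apply]

end Dynamics

end MarketBath

end

set_option maxHeartbeats 1000000 in
theorem mainTheorem3
    {Hm : Type*} [NormedAddCommGroup Hm] [InnerProductSpace ℂ Hm] [CompleteSpace Hm]
    (K : ℕ) (hK : 2 ≤ K)
    (𝒦 : Set ℝ) (h𝒦m : MeasurableSet 𝒦) (h𝒦b : Bornology.IsBounded 𝒦)
    (κ γ : ℝ) (hκγ : 0 ≤ κ * γ)
    (A : MarketBath.Dir → (Hm →L[ℂ] Hm))
    (H' : MarketBath.L2 𝒦 →L[ℂ] MarketBath.L2 𝒦) (hH' : IsSelfAdjoint H')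
    (ρB : MarketBath.L2 𝒦 →L[ℂ] MarketBath.L2 𝒦)
    (hρB : MarketBath.IsDensityOperator ρB) (hstat : ⁅H', ρB⁆ = 0)
    (ρ : ℝ → (MarketBath.HTensor Hm (MarketBath.Env K 𝒦) →L[ℂ]
      MarketBath.HTensor Hm (MarketBath.Env K 𝒦)))
    (hρ0 : MarketBath.IsTraceClass (ρ 0))
    (hρ : MarketBath.IsVonNeumannSolution (MarketBath.hamFull K κ γ A H') ρ)
    (r : Fin K → Fin K → ℝ → ℂ)
    (ρlm : Fin K → Fin K → ℝ → (Hm →L[ℂ] Hm)) :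
    -- the master equation under the Born assumption
    ((∀ t : ℝ, 0 ≤ t → ρ t = MarketBath.bornState ρB r ρlm t) →
      ∀ t : ℝ, 0 ≤ t →
        IntervalIntegrable (MarketBath.memoryKernel κ γ A H' ρB r ρlm t) MeasureTheory.volume 0 t ∧
        HasDerivWithinAt (fun τ => MarketBath.partialTrace (ρ τ))
          (-Complex.I • MarketBath.partialTrace ⁅MarketBath.hamIntI K κ γ A H' t,
              MarketBath.interactionPicture (MarketBath.hamFree Hm K γ H') 0 (ρ 0)⁆
            - ∫ s in (0 : ℝ)..t, MarketBath.memoryKernel κ γ A H' ρB r ρlm t s)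
          (Set.Ici 0) t) ∧
    -- without it, the exact equation, with the remainder that the Born approximation drops
    ((∀ l m, ContinuousOn (fun s => r l m s • ρlm l m s) (Set.Ici 0)) →
      (∀ l m s, 0 ≤ s → MarketBath.IsTraceClass (ρlm l m s)) →
      ∀ t : ℝ, 0 ≤ t →
        IntervalIntegrable (MarketBath.memoryKernel κ γ A H' ρB r ρlm t) MeasureTheory.volume 0 t ∧
        IntervalIntegrable (MarketBath.bornRemainder κ γ A H' ρB r ρlm ρ t)
          MeasureTheory.volume 0 t ∧
        HasDerivWithinAt (fun τ => MarketBath.partialTrace (ρ τ))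
          (-Complex.I • MarketBath.partialTrace ⁅MarketBath.hamIntI K κ γ A H' t,
              MarketBath.interactionPicture (MarketBath.hamFree Hm K γ H') 0 (ρ 0)⁆
            - (∫ s in (0 : ℝ)..t, MarketBath.memoryKernel κ γ A H' ρB r ρlm t s)
            - ∫ s in (0 : ℝ)..t, MarketBath.bornRemainder κ γ A H' ρB r ρlm ρ t s)
          (Set.Ici 0) t) := by
  have hTB : MarketBath.IsTraceClass ρB := hρB.2.1
  have h0 : MarketBath.interactionPicture (MarketBath.hamFree Hm K γ H') 0 (ρ 0) = ρ 0 := by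
    rw [MarketBath.interactionPicture_eq_rotate, MarketBath.rotate]
    simp
  rw [h0]
  have hHI (t : ℝ) : MarketBath.hamIntI K κ γ A H' t = MarketBath.rotate
      (MarketBath.hamFree Hm K γ H') (MarketBath.hamInt K 𝒦 κ γ A) t :=
    MarketBath.interactionPicture_eq_rotate _ _ _
  have hsub {t : ℝ} (ht : 0 ≤ t) : Set.uIcc 0 t ⊆ Set.Ici (0 : ℝ) := by
    rw [Set.uIcc_of_le ht]
    exact Set.Icc_subset_Ici_self
  refine ⟨fun hborn t ht => ?_, fun hcont _ t ht => ?_⟩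
  · obtain ⟨g, hgc, hg, hd⟩ := MarketBath.hasDerivWithinAt_partialTrace hρ0 hρ ht
    -- On a state of Born form the integrand of the exact equation is the memory kernel itself.
    have hmem : Set.EqOn (MarketBath.memoryKernel κ γ A H' ρB r ρlm t) g (Set.Ici 0) := by
      intro s hs
      have h1 := MarketBath.hasPartialTrace_memoryKernel (A := A) (r := r) (ρlm := ρlm) hκγ hTB
        hstat t s
      rw [← hborn s hs, hHI, hHI] at h1
      exact h1.eq.symm.trans (hg s hs).eq
    refine ⟨((hgc.continuousOn.congr hmem).mono (hsub ht)).intervalIntegrable, ?_⟩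
    rw [intervalIntegral.integral_congr (hmem.mono (hsub ht)), hHI]
    exact hd
  · obtain ⟨g, hgc, hg, hd⟩ := MarketBath.hasDerivWithinAt_partialTrace hρ0 hρ ht
    have hmem := MarketBath.continuousOn_memoryKernel (κ := κ) (γ := γ) (A := A) (H' := H') hTB
      hcont t
    -- The deviation from the Born form carries the rest of the exact integrand.
    have hrem : Set.EqOn (MarketBath.bornRemainder κ γ A H' ρB r ρlm ρ t)
        (fun s => g s - MarketBath.memoryKernel κ γ A H' ρB r ρlm t s) (Set.Ici 0) := by
      intro s hs
      have h1 := MarketBath.hasPartialTrace_memoryKernel (A := A) (r := r) (ρlm := ρlm) hκγ hTB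
        hstat t s
      rw [hHI, hHI] at h1
      have h2 := (hg s hs).lie_lie_rotate_sub h1
      rw [MarketBath.bornRemainder, MarketBath.interactionPicture_eq_rotate, hHI, hHI]
      exact h2.eq
    have hmi : IntervalIntegrable (MarketBath.memoryKernel κ γ A H' ρB r ρlm t) volume 0 t :=
      (hmem.mono (hsub ht)).intervalIntegrable
    have hgi : IntervalIntegrable g volume 0 t := hgc.intervalIntegrable _ _
    refine ⟨hmi, (((hgc.continuousOn.sub hmem).congr hrem).mono (hsub ht)).intervalIntegrable, ?_⟩
    rw [intervalIntegral.integral_congr (hrem.mono (hsub ht)),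
      intervalIntegral.integral_sub hgi hmi, sub_sub, add_sub_cancel, hHI]
    exact hd
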